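/- **Conventions.** A Fuchsian group of the first kind is a discrete subgroup $G$ of $\mathrm{PSL}_2(\mathbb R)$ having a fundamental domain of finite hyperbolic area in the upper half plane $\mathbb H$. Write $j(\gamma,\tau)=c\tau+d$ for $\gamma=\pm\begin{pmatrix}a&b\\c&d\end{pmatrix}$; its even powers are well defined. Put $A_\infty=1$ and $A_{\mathfrak c}=\pm\begin{pmatrix}\mathfrak c&-1\\1&0\end{pmatrix}$ for $\mathfrak c\in\mathbb R$, so that $A_{\mathfrak c}\infty=\mathfrak c$. A point $\mathfrak c\in\mathbb R\cup\{\infty\}$ is a cusp of $G$ of width $h>0$ if its stabilizer in $G$ is generated by $t_{\mathfrak c}=A_{\mathfrak c}\begin{pmatrix}1&h\\0&1\end{pmatrix}A_{\mathfrak c}^{-1}$; put $q_{\mathfrak c}=\exp(2\pi i A_{\mathfrak c}^{-1}\tau/h)$. A representation $\rho:G\to\mathrm{GL}_d(\mathbb C)$ is an admissible multiplier if $\rho(t_{\mathfrak c})$ is diagonalizable for every cusp $\mathfrak c$ of $G$, i.e. $P^{-1}\rho(t_{\mathfrak c})P=\exp(2\pi i\Lambda)$ for some $P\in\mathrm{GL}_d(\mathbb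 C)$ and some diagonal matrix $\Lambda$. For $w$ even, $\mathrm M^!_w(\rho)$ is the space of holomorphic functions $X:\mathbb H\to\mathbb C^d$ such that $X(\gamma\tau)=j(\gamma,\tau)^w\rho(\gamma)X(\tau)$ for all $\gamma\in G$, $\tau\in\mathbb H$, and such that at every cusp $\mathfrak c$, with $P,\Lambda$ as above and $q_{\mathfrak c}^{\Lambda}=\exp(2\pi i\Lambda A_{\mathfrak c}^{-1}\tau/h)$, $$X(\tau)=j(A_{\mathfrak c}^{-1},\tau)^{-w}\,P\,q_{\mathfrak c}^{\Lambda}P^{-1}\sum_{n\ge -M}X_n\,q_{\mathfrak c}^{\,n}\qquad(M\in\mathbb Z,\ X_n\in\mathbb C^d).$$ $R_G=\mathrm M^!_0(1)$ is the ring of scalar weakly holomorphic modular functions of $G$; it acts by pointwise multiplication. **Theorem.** Let $G$ be a Fuchsian group of the first kind, $H\le G$ a subgroup of finite index $m$, $\rho:H\to\mathrm{GL}_d(\mathbb C)$ an admissible multiplier of $H$, and $w$ an even integer. Let $\gamma_1,\dots,\gamma_m$ be representatives of the left cosets of $H$ in $G$, and let $\tilde\rho=\mathrm{Ind}_H^G\rho:G\to\mathrm{GL}_{dm}(\mathbb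 C)$ be the representation $\tilde\rho(x)=\big(\rho(\gamma_i^{-1}x\gamma_j)\big)_{i,j}$, where $\rho$ is extended by $0$ outside $H$. Then $\tilde\rho$ is an admissible multiplier of $G$; $\mathrm M^!_w(\rho)$ and $\mathrm M^!_w(\tilde\rho)$ are $R_G$-modules; and $$X\longmapsto\Big(j(\gamma_1^{-1},\tau)^{-w}X(\gamma_1^{-1}\tau),\ \dots,\ j(\gamma_m^{-1},\tau)^{-w}X(\gamma_m^{-1}\tau)\Big)^{\mathfrak t}$$ is an isomorphism of $R_G$-modules $\mathrm M^!_w(\rho)\to\mathrm M^!_w(\tilde\rho)$ (for $w=0$ it is $X\mapsto(X(\gamma_1^{-1}\tau),\dots,X(\gamma_m^{-1}\tau))^{\mathfrak t}$). If $\gamma_1=1$, its inverse takes the first $d$ components. -/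

import Mathlib

open Matrix UpperHalfPlane MeasureTheory
open scoped MatrixGroups Manifold

noncomputable section

namespace VVMF

/-! ### `PSL(2, ℝ)`, its action on the upper half plane, Fuchsian groups of the first kind -/

/-- The quotient map `SL(2, ℝ) → PSL(2, ℝ)`. -/
def toPSL : SL(2, ℝ) →* PSL(2, ℝ) := QuotientGroup.mk' _

/-- The Möbius action of `PSL(2, ℝ)` on the upper half plane. -/
instance pslAction : MulAction PSL(2, ℝ) ℍ :=
  MulAction.compHom ℍ (Matrix.ProjectiveSpecialLinearGroup.toPGL (n := Fin 2) (R := ℝ))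

theorem toPSL_smul (s : SL(2, ℝ)) (τ : ℍ) : toPSL s • τ = s • τ := by
  have h : toPSL s • τ =
      (Matrix.ProjGenLinGroup.mk (Matrix.SpecialLinearGroup.toGL s)) • τ := rfl
  rw [h, UpperHalfPlane.pglMk_smul]
  rfl

/-- A Fuchsian group of the first kind: a discrete subgroup of `PSL(2, ℝ)` with a fundamental
domain in `ℍ` of finite hyperbolic area (the measure `volume` of `ℍ` is `dx dy / y ^ 2`). -/
structure IsFuchsianFirstKind (G : Subgroup PSL(2, ℝ)) : Prop where
  discrete : DiscreteTopology G
  finite_area : ∃ F : Set ℍ, IsFundamentalDomain G F (volume : Measure ℍ) ∧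
    (volume : Measure ℍ) F < ⊤

/-- The automorphy factor `j(s, τ) = c τ + d` of `s = (a b; c d)`. Its even powers depend only on
the image of `s` in `PSL(2, ℝ)`. -/
def autFactor (s : SL(2, ℝ)) (τ : ℍ) : ℂ := (s 1 0 : ℂ) * (τ : ℂ) + (s 1 1 : ℂ)

/-! ### Cusps -/

/-- The translation matrix `(1 x; 0 1)`. -/
def transl (x : ℝ) : SL(2, ℝ) := ⟨!![1, x; 0, 1], by simp⟩

/-- The matrix `A_c` with `A_c ∞ = c`: the identity for `c = ∞`, and `(c -1; 1 0)` for real `c`. -/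
def cuspMatrix (c : OnePoint ℝ) : SL(2, ℝ) :=
  c.elim 1 fun x => ⟨!![x, -1; 1, 0], by simp⟩

/-- The parabolic element `A_c (1 h; 0 1) A_c⁻¹` of `PSL(2, ℝ)`. -/
def cuspGen (c : OnePoint ℝ) (h : ℝ) : PSL(2, ℝ) :=
  toPSL (cuspMatrix c * transl h * (cuspMatrix c)⁻¹)

/-- `c ∈ ℝ ∪ {∞}` is a cusp of `G` of cusp width `h`: `h > 0` and the stabilizer of `c` in `G` is
generated by `t_c = A_c (1 h; 0 1) A_c⁻¹`. For a discrete group, the points with such a width are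
exactly the fixed points of nontrivial parabolic elements of `G`, and the width is unique. -/
structure IsCuspOfWidth (G : Subgroup PSL(2, ℝ)) (c : OnePoint ℝ) (h : ℝ) : Prop where
  pos : 0 < h
  stabilizer : ∀ s : SL(2, ℝ), (toPSL s ∈ G ∧ Matrix.SpecialLinearGroup.toGL s • c = c) ↔
    toPSL s ∈ Subgroup.zpowers (cuspGen c h)

theorem IsCuspOfWidth.mem {G : Subgroup PSL(2, ℝ)} {c : OnePoint ℝ} {h : ℝ}
    (hc : IsCuspOfWidth G c h) : cuspGen c h ∈ G :=
  ((hc.stabilizer _).2 (Subgroup.mem_zpowers _)).1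

/-- The local parameter `q_c(τ) = exp (2 π i (A_c⁻¹ τ) / h)` at a cusp `c` of width `h`. -/
def localParam (c : OnePoint ℝ) (h : ℝ) (τ : ℍ) : ℂ :=
  Complex.exp (2 * Real.pi * Complex.I * (((cuspMatrix c)⁻¹ • τ : ℍ) : ℂ) / h)

/-! ### Admissible multipliers and weakly holomorphic vector-valued modular forms -/

section Forms

variable {ι : Type*} [Fintype ι] [DecidableEq ι]

/-- `Λ` is (the diagonal of) an exponent matrix of `ρ` at the cusp `c`, with diagonalizing matrix
`P`: `P⁻¹ ρ(t_c) P = exp (2 π i Λ)`. -/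
def IsExponent {G : Subgroup PSL(2, ℝ)} (ρ : G →* GL ι ℂ) {c : OnePoint ℝ} {h : ℝ}
    (hc : IsCuspOfWidth G c h) (P : GL ι ℂ) (Λ : ι → ℂ) : Prop :=
  ((P⁻¹ * ρ ⟨cuspGen c h, hc.mem⟩ * P : GL ι ℂ) : Matrix ι ι ℂ) =
    Matrix.diagonal fun i => Complex.exp (2 * Real.pi * Complex.I * Λ i)

/-- A representation `ρ` of `G` is an admissible multiplier if `ρ(t_c)` is diagonalizable for every
cusp `c` of `G`. No basis in which `ρ(t_∞)` is diagonal is fixed. -/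
def IsAdmissible (G : Subgroup PSL(2, ℝ)) (ρ : G →* GL ι ℂ) : Prop :=
  ∀ (c : OnePoint ℝ) (h : ℝ) (hc : IsCuspOfWidth G c h),
    ∃ (P : GL ι ℂ) (Λ : ι → ℂ), IsExponent ρ hc P Λ

/-- The diagonal matrix `q_c ^ Λ = exp (2 π i Λ (A_c⁻¹ τ) / h)`. -/
def localParamPow (c : OnePoint ℝ) (h : ℝ) (Λ : ι → ℂ) (τ : ℍ) : Matrix ι ι ℂ :=
  Matrix.diagonal fun i =>
    Complex.exp (2 * Real.pi * Complex.I * Λ i * (((cuspMatrix c)⁻¹ • τ : ℍ) : ℂ) / h)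

/-- `X(τ) = j(A_c⁻¹, τ) ^ (-w) P q_c ^ Λ P⁻¹ ∑_{n ≥ -M} a_n q_c ^ n` for all `τ ∈ ℍ`, where
`j(A_c⁻¹, τ)` is `1` for `c = ∞` and `c - τ` for real `c`. The series, with value `S(τ)`, is
indexed by `n + M ∈ ℕ`. -/
def HasCuspExpansion (w : ℤ) (X : ℍ → ι → ℂ) (c : OnePoint ℝ) (h : ℝ)
    (P : GL ι ℂ) (Λ : ι → ℂ) : Prop :=
  ∃ (M : ℤ) (a : ℕ → ι → ℂ) (S : ℍ → ι → ℂ), ∀ τ : ℍ,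
    HasSum (fun n : ℕ => localParam c h τ ^ ((n : ℤ) - M) • a n) (S τ) ∧
    X τ = autFactor (cuspMatrix c)⁻¹ τ ^ (-w) •
      (((P : Matrix ι ι ℂ) * localParamPow c h Λ τ * ((P⁻¹ : GL ι ℂ) : Matrix ι ι ℂ)) *ᵥ S τ)

/-- `X` is a weakly holomorphic vector-valued modular form for `G` of (even) weight `w` with
multiplier `ρ`. For an admissible `ρ` the condition at a cusp does not depend on the choice of the
exponent `Λ` and of the diagonalizing matrix `P`. -/
structure IsWeaklyHolomorphic (G : Subgroup PSL(2, ℝ)) (w : ℤ) (ρ : G →* GL ι ℂ)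
    (X : ℍ → ι → ℂ) : Prop where
  holo : ∀ i, MDifferentiable 𝓘(ℂ) 𝓘(ℂ) fun τ => X τ i
  transform : ∀ (s : SL(2, ℝ)) (hs : toPSL s ∈ G) (τ : ℍ),
    X (s • τ) = autFactor s τ ^ w • ((ρ ⟨toPSL s, hs⟩ : Matrix ι ι ℂ) *ᵥ X τ)
  cusp : ∀ (c : OnePoint ℝ) (h : ℝ) (hc : IsCuspOfWidth G c h) (P : GL ι ℂ) (Λ : ι → ℂ),
    IsExponent ρ hc P Λ → HasCuspExpansion w X c h P Λ

theorem localParam_ne_zero (c : OnePoint ℝ) (h : ℝ) (τ : ℍ) : localParam c h τ ≠ 0 :=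
  Complex.exp_ne_zero _

theorem hasSum_shift {E : Type*} [AddCommGroup E] [Module ℂ E] [TopologicalSpace E]
    {q : ℂ} {M : ℤ} {a : ℕ → E} {S : E}
    (hS : HasSum (fun n : ℕ => q ^ ((n : ℤ) - M) • a n) S) (k : ℕ) :
    HasSum (fun n : ℕ => q ^ ((n : ℤ) - (M + k)) • if n < k then 0 else a (n - k)) S := by
  refine (Function.Injective.hasSum_iff (add_left_injective k) ?_).1 ?_
  · intro n hn
    have : n < k := by
      by_contra hnk
      exact hn ⟨n - k, by simp only; omega⟩
    simp [this]
  · convert hS using 2 with n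
    simp

/-- Weakly holomorphic forms at a cusp are closed under addition. -/
theorem HasCuspExpansion.add {w : ℤ} {X Y : ℍ → ι → ℂ} {c : OnePoint ℝ} {h : ℝ}
    {P : GL ι ℂ} {Λ : ι → ℂ} (hX : HasCuspExpansion w X c h P Λ)
    (hY : HasCuspExpansion w Y c h P Λ) : HasCuspExpansion w (X + Y) c h P Λ := by
  obtain ⟨M, a, S, hS⟩ := hX
  obtain ⟨N, b, T, hT⟩ := hY
  obtain ⟨k, l, hkl⟩ : ∃ k l : ℕ, M + k = N + l :=
    ⟨(N - M).toNat, (M - N).toNat, by omega⟩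
  refine ⟨M + k, fun n => (if n < k then 0 else a (n - k)) + (if n < l then 0 else b (n - l)),
    S + T, fun τ => ⟨?_, ?_⟩⟩
  rotate_left
  · simp only [Pi.add_apply, (hS τ).2, (hT τ).2, mulVec_add, smul_add]
  · have h1 := hasSum_shift (hS τ).1 k
    have h2 := hasSum_shift (hT τ).1 l
    rw [← hkl] at h2
    have h3 := h1.add h2
    simp only [← smul_add] at h3
    exact h3

theorem hasCuspExpansion_zero (w : ℤ) (c : OnePoint ℝ) (h : ℝ) (P : GL ι ℂ) (Λ : ι → ℂ) :
    HasCuspExpansion w 0 c h P Λ :=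
  ⟨0, 0, 0, fun τ => ⟨by simp, by simp⟩⟩

/-- `f(τ) = ∑_{n ≥ -M} a_n q_c ^ n` for all `τ ∈ ℍ`. -/
def HasScalarExpansion (f : ℍ → ℂ) (c : OnePoint ℝ) (h : ℝ) : Prop :=
  ∃ (M : ℤ) (a : ℕ → ℂ), ∀ τ : ℍ,
    HasSum (fun n : ℕ => localParam c h τ ^ ((n : ℤ) - M) • a n) (f τ)

theorem hasSum_laurent_mul {q : ℂ} (hq : q ≠ 0) {M N : ℤ} {a b : ℕ → ℂ} {s t : ℂ}
    (hs : HasSum (fun n : ℕ => q ^ ((n : ℤ) - M) • a n) s)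
    (ht : HasSum (fun n : ℕ => q ^ ((n : ℤ) - N) • b n) t) :
    HasSum (fun n : ℕ => q ^ ((n : ℤ) - (M + N)) •
      ∑ kl ∈ Finset.HasAntidiagonal.antidiagonal n, a kl.1 * b kl.2) (s * t) := by
  have h1 := hs.summable.norm
  have h2 := ht.summable.norm
  have h3 := (summable_norm_sum_mul_antidiagonal_of_summable_norm h1 h2).of_norm.hasSum
  rw [← tsum_mul_tsum_eq_tsum_sum_antidiagonal_of_summable_norm h1 h2, hs.tsum_eq,
    ht.tsum_eq] at h3
  refine HasSum.congr_fun h3 fun n => ?_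
  rw [Finset.smul_sum]
  refine Finset.sum_congr rfl fun kl hkl => ?_
  have : (n : ℤ) - (M + N) = ((kl.1 : ℤ) - M) + ((kl.2 : ℤ) - N) := by
    have := Finset.HasAntidiagonal.mem_antidiagonal.1 hkl
    omega
  rw [this, zpow_add₀ hq]
  simp only [smul_eq_mul]
  ring

theorem HasScalarExpansion.smul {f : ℍ → ℂ} {w : ℤ} {X : ℍ → ι → ℂ} {c : OnePoint ℝ} {h : ℝ}
    {P : GL ι ℂ} {Λ : ι → ℂ} (hf : HasScalarExpansion f c h)
    (hX : HasCuspExpansion w X c h P Λ) : HasCuspExpansion w (f • X) c h P Λ := by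
  obtain ⟨M, a, hS⟩ := hf
  obtain ⟨N, b, T, hT⟩ := hX
  refine ⟨M + N, fun n i => ∑ kl ∈ Finset.HasAntidiagonal.antidiagonal n, a kl.1 * b kl.2 i, f • T,
    fun τ => ⟨?_, ?_⟩⟩
  · rw [Pi.hasSum]
    intro i
    have h1 : HasSum (fun n : ℕ => localParam c h τ ^ ((n : ℤ) - N) • b n i) (T τ i) :=
      Pi.hasSum.1 (hT τ).1 i
    have h2 := hasSum_laurent_mul (localParam_ne_zero c h τ) (hS τ) h1
    refine HasSum.congr_fun h2 fun n => ?_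
    simp only [Pi.smul_apply]
  · simp only [Pi.smul_apply', (hT τ).2, mulVec_smul]
    rw [smul_comm]

theorem HasScalarExpansion.mul {f g : ℍ → ℂ} {c : OnePoint ℝ} {h : ℝ}
    (hf : HasScalarExpansion f c h) (hg : HasScalarExpansion g c h) :
    HasScalarExpansion (f * g) c h := by
  obtain ⟨M, a, hS⟩ := hf
  obtain ⟨N, b, hT⟩ := hg
  exact ⟨M + N, _, fun τ => hasSum_laurent_mul (localParam_ne_zero c h τ) (hS τ) (hT τ)⟩

theorem HasScalarExpansion.add {f g : ℍ → ℂ} {c : OnePoint ℝ} {h : ℝ}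
    (hf : HasScalarExpansion f c h) (hg : HasScalarExpansion g c h) :
    HasScalarExpansion (f + g) c h := by
  obtain ⟨M, a, hS⟩ := hf
  obtain ⟨N, b, hT⟩ := hg
  obtain ⟨k, l, hkl⟩ : ∃ k l : ℕ, M + k = N + l :=
    ⟨(N - M).toNat, (M - N).toNat, by omega⟩
  refine ⟨M + k, fun n => (if n < k then 0 else a (n - k)) + (if n < l then 0 else b (n - l)),
    fun τ => ?_⟩
  have h1 := hasSum_shift (hS τ) k
  have h2 := hasSum_shift (hT τ) l
  rw [← hkl] at h2
  have h3 := h1.add h2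
  simp only [← smul_add] at h3
  exact h3

theorem hasScalarExpansion_const (z : ℂ) (c : OnePoint ℝ) (h : ℝ) :
    HasScalarExpansion (fun _ => z) c h := by
  refine ⟨0, fun n => if n = 0 then z else 0, fun τ => ?_⟩
  convert hasSum_ite_eq (0 : ℕ) z using 2 with n
  split_ifs with hn <;> simp [hn]

/-- `f` is a scalar weakly holomorphic modular function for `G`: an element of the space of
weakly holomorphic forms of weight `0` for the trivial multiplier of rank `1`. -/
def IsModularFunction (G : Subgroup PSL(2, ℝ)) (f : ℍ → ℂ) : Prop :=
  IsWeaklyHolomorphic G 0 (1 : G →* GL (Fin 1) ℂ) fun τ _ => f τ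

theorem isModularFunction_iff {G : Subgroup PSL(2, ℝ)} {f : ℍ → ℂ} :
    IsModularFunction G f ↔ MDifferentiable 𝓘(ℂ) 𝓘(ℂ) f ∧
      (∀ s : SL(2, ℝ), toPSL s ∈ G → ∀ τ : ℍ, f (s • τ) = f τ) ∧
      ∀ (c : OnePoint ℝ) (h : ℝ), IsCuspOfWidth G c h → HasScalarExpansion f c h := by
  constructor
  · intro H
    refine ⟨H.holo 0, fun s hs τ => ?_, fun c h hc => ?_⟩
    · simpa using congrFun (H.transform s hs τ) 0
    · obtain ⟨M, a, S, hS⟩ := H.cusp c h hc 1 0 (by simp [IsExponent])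
      refine ⟨M, fun n => a n 0, fun τ => ?_⟩
      have h1 := Pi.hasSum.1 (hS τ).1 0
      have h2 := congrFun (hS τ).2 0
      simp [localParamPow] at h2
      rw [h2]
      exact h1
  · rintro ⟨h1, h2, h3⟩
    refine ⟨fun _ => h1, fun s hs τ => ?_, fun c h hc P Λ hΛ => ?_⟩
    · ext i
      simp [h2 s hs τ]
    · have hΛ' : Complex.exp (2 * Real.pi * Complex.I * Λ 0) = 1 := by
        have := congrFun (congrFun hΛ 0) 0
        simpa using this.symm
      obtain ⟨N, hN⟩ := Complex.exp_eq_one_iff.1 hΛ'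
      have hΛN : Λ 0 = N := by
        have h2pi : (2 * Real.pi * Complex.I : ℂ) ≠ 0 := Complex.two_pi_I_ne_zero
        apply mul_left_cancel₀ h2pi
        rw [hN]
        ring
      obtain ⟨M, a, hS⟩ := h3 c h hc
      refine ⟨M + N, fun n _ => a n, fun τ _ => localParam c h τ ^ (-N) * f τ, fun τ => ⟨?_, ?_⟩⟩
      · rw [Pi.hasSum]
        intro i
        refine HasSum.congr_fun ((hS τ).mul_left (localParam c h τ ^ (-N))) fun n => ?_
        rw [Pi.smul_apply, smul_eq_mul, smul_eq_mul, ← mul_assoc,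
          ← zpow_add₀ (localParam_ne_zero c h τ)]
        congr 2
        ring
      · have hpow : localParamPow c h Λ τ = localParam c h τ ^ N • (1 : Matrix (Fin 1) (Fin 1) ℂ) := by
          ext i j
          rw [Subsingleton.elim i 0, Subsingleton.elim j 0]
          simp only [localParamPow, diagonal_apply_eq, Matrix.smul_apply, one_apply_eq, hΛN,
            localParam, ← Complex.exp_int_mul, smul_eq_mul, mul_one]
          congr 1
          ring
        rw [hpow]
        ext i
        have hPP : (P : Matrix (Fin 1) (Fin 1) ℂ) * ((P⁻¹ : GL (Fin 1) ℂ) : Matrix (Fin 1) (Fin 1) ℂ) = 1 :=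
          Units.mul_inv P
        simp only [Matrix.mul_smul, mul_one, Matrix.smul_mul, hPP, neg_zero, zpow_zero,
          smul_mulVec, one_mulVec, Pi.smul_apply, smul_eq_mul]
        rw [one_mul, ← mul_assoc, ← zpow_add₀ (localParam_ne_zero c h τ)]
        simp

/-- The ring `R_G` of scalar weakly holomorphic modular functions of `G`. -/
def modularFunctionRing (G : Subgroup PSL(2, ℝ)) : Subalgebra ℂ (ℍ → ℂ) where
  carrier := {f | IsModularFunction G f}
  mul_mem' {f g} hf hg := by
    obtain ⟨f1, f2, f3⟩ := isModularFunction_iff.1 hf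
    obtain ⟨g1, g2, g3⟩ := isModularFunction_iff.1 hg
    exact isModularFunction_iff.2 ⟨f1.mul g1, fun s hs τ => by simp [f2 s hs τ, g2 s hs τ],
      fun c h hc => (f3 c h hc).mul (g3 c h hc)⟩
  add_mem' {f g} hf hg := by
    obtain ⟨f1, f2, f3⟩ := isModularFunction_iff.1 hf
    obtain ⟨g1, g2, g3⟩ := isModularFunction_iff.1 hg
    exact isModularFunction_iff.2 ⟨f1.add g1, fun s hs τ => by simp [f2 s hs τ, g2 s hs τ],
      fun c h hc => (f3 c h hc).add (g3 c h hc)⟩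
  algebraMap_mem' z :=
    isModularFunction_iff.2 ⟨mdifferentiable_const, fun _ _ _ => rfl,
      fun c h _ => hasScalarExpansion_const z c h⟩

/-- The space `M^!_w(ρ)` of weakly holomorphic vector-valued modular forms for `H`, as a module
(under pointwise multiplication) over a ring `R` of modular functions of `H`. -/
def weaklyHolomorphicForms (H : Subgroup PSL(2, ℝ)) (w : ℤ) (ρ : H →* GL ι ℂ)
    (R : Subalgebra ℂ (ℍ → ℂ)) (hR : R ≤ modularFunctionRing H) :
    Submodule R (ℍ → ι → ℂ) where
  carrier := {X | IsWeaklyHolomorphic H w ρ X}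
  add_mem' {X Y} hX hY :=
    { holo := fun i => (hX.holo i).add (hY.holo i)
      transform := fun s hs τ => by
        simp only [Pi.add_apply, hX.transform s hs τ, hY.transform s hs τ, mulVec_add, smul_add]
      cusp := fun c h hc P Λ hΛ => (hX.cusp c h hc P Λ hΛ).add (hY.cusp c h hc P Λ hΛ) }
  zero_mem' :=
    { holo := fun _ => mdifferentiable_const
      transform := fun s hs τ => by simp
      cusp := fun c h _ P Λ _ => hasCuspExpansion_zero w c h P Λ }
  smul_mem' f X hX := by
    obtain ⟨f1, f2, f3⟩ := isModularFunction_iff.1 (hR f.2)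
    exact
    { holo := fun i => f1.mul (hX.holo i)
      transform := fun s hs τ => by
        have hd : ∀ τ, (f • X) τ = f.1 τ • X τ := fun _ => rfl
        rw [hd, hd, f2 s hs τ, hX.transform s hs τ, mulVec_smul, smul_comm]
      cusp := fun c h hc P Λ hΛ => (f3 c h hc).smul (hX.cusp c h hc P Λ hΛ) }

end Forms

/-! ### Cusps of subgroups of finite index -/

theorem toPSL_eq_iff {s t : SL(2, ℝ)} : toPSL s = toPSL t ↔ s = t ∨ s = -t := by
  constructor
  · intro hst
    have h1 : s⁻¹ * t ∈ Subgroup.center SL(2, ℝ) := QuotientGroup.eq.1 hst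
    obtain ⟨r, hr, hrs⟩ := Matrix.SpecialLinearGroup.mem_center_iff.1 h1
    have h2 : (t : Matrix (Fin 2) (Fin 2) ℝ) = r • (s : Matrix (Fin 2) (Fin 2) ℝ) := by
      have h3 : t = s * (s⁻¹ * t) := by group
      rw [h3, Matrix.SpecialLinearGroup.coe_mul, ← hrs]
      simp [← Matrix.smul_one_eq_diagonal]
    rw [Fintype.card_fin] at hr
    rcases (sq_eq_sq_iff_eq_or_eq_neg.1 (hr.trans (one_pow 2).symm)) with rfl | rfl
    · left
      exact Subtype.ext (by simp [h2])
    · right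
      exact Subtype.ext (by simp [h2])
  · rintro (rfl | rfl)
    · rfl
    · refine QuotientGroup.eq.2 (Matrix.SpecialLinearGroup.mem_center_iff.2 ⟨-1, by simp, ?_⟩)
      ext i j
      fin_cases i <;> fin_cases j <;> simp

theorem coe_transl (x : ℝ) :
    (transl x : Matrix (Fin 2) (Fin 2) ℝ) = !![1, x; 0, 1] := rfl

theorem coe_neg_transl (x : ℝ) :
    ((-transl x : SL(2, ℝ)) : Matrix (Fin 2) (Fin 2) ℝ) = -!![1, x; 0, 1] := rfl

theorem transl_zero : transl 0 = 1 := Subtype.ext Matrix.one_fin_two.symm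

theorem transl_add (x y : ℝ) : transl (x + y) = transl x * transl y := by
  apply Subtype.ext
  rw [Matrix.SpecialLinearGroup.coe_mul, coe_transl, coe_transl, coe_transl, Matrix.mul_fin_two]
  simp [add_comm]

/-- The homomorphism `x ↦ A_c (1 x; 0 1) A_c⁻¹` from `ℝ` to `PSL(2, ℝ)`. -/
def cuspHom (c : OnePoint ℝ) : Multiplicative ℝ →* PSL(2, ℝ) :=
  MonoidHom.mk' (fun x => cuspGen c x.toAdd) fun x y => by
    simp only [cuspGen, toAdd_mul, transl_add, ← map_mul]
    congr 1
    group

theorem cuspGen_zpow (c : OnePoint ℝ) (x : ℝ) (n : ℤ) : cuspGen c x ^ n = cuspGen c (n * x) := by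
  have := (map_zpow (cuspHom c) (Multiplicative.ofAdd x) n).symm
  simpa [cuspHom, ← ofAdd_zsmul] using this

theorem cuspGen_add (c : OnePoint ℝ) (x y : ℝ) :
    cuspGen c (x + y) = cuspGen c x * cuspGen c y :=
  map_mul (cuspHom c) (Multiplicative.ofAdd x) (Multiplicative.ofAdd y)

theorem cuspGen_injective (c : OnePoint ℝ) : Function.Injective (cuspGen c) := by
  intro x y hxy
  have h1 : toPSL (transl x) = toPSL (transl y) := by
    simpa [cuspGen] using hxy
  rcases toPSL_eq_iff.1 h1 with h | h
  · have := congrArg (fun s : SL(2, ℝ) => s 0 1) h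
    simpa [transl] using this
  · have := congrArg (fun s : SL(2, ℝ) => s 0 0) h
    norm_num [coe_neg_transl, coe_transl] at this

theorem toGL_cuspMatrix_smul (c : OnePoint ℝ) :
    Matrix.SpecialLinearGroup.toGL (cuspMatrix c) • (OnePoint.infty : OnePoint ℝ) = c := by
  induction c with
  | infty =>
    have h1 : cuspMatrix OnePoint.infty = 1 := rfl
    rw [h1, map_one, one_smul]
  | coe x =>
    have h1 : (Matrix.SpecialLinearGroup.toGL (cuspMatrix (x : OnePoint ℝ)) :
      Matrix (Fin 2) (Fin 2) ℝ) = !![x, -1; 1, 0] := rfl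
    rw [OnePoint.smul_infty_eq_ite, h1]
    simp

/-- A matrix fixes `c` iff its conjugate by `A_c` is upper triangular. -/
theorem fixes_iff (c : OnePoint ℝ) (s : SL(2, ℝ)) :
    Matrix.SpecialLinearGroup.toGL s • c = c ↔
      ((cuspMatrix c)⁻¹ * s * cuspMatrix c : SL(2, ℝ)) 1 0 = 0 := by
  have h1 := OnePoint.smul_infty_eq_self_iff (K := ℝ)
    (g := Matrix.SpecialLinearGroup.toGL ((cuspMatrix c)⁻¹ * s * cuspMatrix c))
  rw [map_mul, map_mul, mul_smul, mul_smul, toGL_cuspMatrix_smul, map_inv, inv_smul_eq_iff,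
    toGL_cuspMatrix_smul] at h1
  rw [h1]
  rfl

theorem fixes_of_toPSL_eq_cuspGen {c : OnePoint ℝ} {x : ℝ} {s : SL(2, ℝ)}
    (hs : toPSL s = cuspGen c x) : Matrix.SpecialLinearGroup.toGL s • c = c := by
  rw [fixes_iff]
  rcases toPSL_eq_iff.1 hs with rfl | rfl
  · have : (cuspMatrix c)⁻¹ * (cuspMatrix c * transl x * (cuspMatrix c)⁻¹) * cuspMatrix c =
      transl x := by group
    rw [this]
    simp [coe_neg_transl, coe_transl]
  · have : (cuspMatrix c)⁻¹ * -(cuspMatrix c * transl x * (cuspMatrix c)⁻¹) * cuspMatrix c =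
      -transl x := by simp [mul_assoc]
    rw [this]
    simp [coe_neg_transl, coe_transl]

theorem eq_transl_of_pow {a : SL(2, ℝ)} (ha : a 1 0 = 0) {n : ℕ} (hn : 0 < n) {x : ℝ}
    (h : toPSL (a ^ n) = toPSL (transl x)) : ∃ y, toPSL a = toPSL (transl y) := by
  have hpow : ∀ k : ℕ, (a ^ k) 1 0 = 0 ∧ (a ^ k) 0 0 = a 0 0 ^ k := by
    intro k
    induction k with
    | zero => simp
    | succ k ih =>
      rw [pow_succ, Matrix.SpecialLinearGroup.coe_mul, Matrix.mul_apply, Matrix.mul_apply,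
        Fin.sum_univ_two, Fin.sum_univ_two, ih.1, ih.2, ha, pow_succ]
      simp
  have h1 : |a 0 0| ^ n = 1 := by
    rw [← abs_pow, ← (hpow n).2]
    rcases toPSL_eq_iff.1 h with h | h <;> rw [h] <;> simp [coe_neg_transl, coe_transl]
  have h2 : |a 0 0| = 1 := (pow_eq_one_iff_of_nonneg (abs_nonneg _) hn.ne').1 h1
  have hdet : a 0 0 * a 1 1 = 1 := by
    have := a.det_coe
    rw [Matrix.det_fin_two] at this
    simpa [ha] using this
  rcases (abs_eq zero_le_one).1 h2 with h3 | h3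
  · refine ⟨a 0 1, congrArg _ ?_⟩
    rw [h3] at hdet
    ext i j
    fin_cases i <;> fin_cases j <;> simp [coe_neg_transl, coe_transl, ha, h3]
    linarith
  · refine ⟨-a 0 1, toPSL_eq_iff.2 (Or.inr ?_)⟩
    rw [h3] at hdet
    ext i j
    fin_cases i <;> fin_cases j <;> simp [coe_neg_transl, coe_transl, ha, h3]
    linarith

/-- A cusp of width `h` of a subgroup `H` of finite index in `G` is a cusp of `G`, of a width `k`
that divides `h`. -/
theorem IsCuspOfWidth.of_le {G H : Subgroup PSL(2, ℝ)} (hHG : H ≤ G) (hfin : H.relIndex G ≠ 0)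
    {c : OnePoint ℝ} {h : ℝ} (hc : IsCuspOfWidth H c h) :
    ∃ (k : ℝ) (l : ℕ), 0 < l ∧ IsCuspOfWidth G c k ∧ h = l * k := by
  have key : ∀ x : ℝ, cuspGen c x ∈ H → ∃ z : ℤ, x = z * h := by
    intro x hx
    have h1 := (hc.stabilizer (cuspMatrix c * transl x * (cuspMatrix c)⁻¹)).1
      ⟨hx, fixes_of_toPSL_eq_cuspGen (x := x) rfl⟩
    obtain ⟨z, hz⟩ := Subgroup.mem_zpowers_iff.1 h1
    rw [cuspGen_zpow] at hz
    exact ⟨z, (cuspGen_injective c hz).symm⟩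
  have claim : ∀ s : SL(2, ℝ), toPSL s ∈ G → Matrix.SpecialLinearGroup.toGL s • c = c →
      ∃ x, toPSL s = cuspGen c x := by
    intro s hs hsc
    obtain ⟨n, hn, -, hmem⟩ := Subgroup.exists_pow_mem_of_relIndex_ne_zero hfin hs
    have hfix : Matrix.SpecialLinearGroup.toGL (s ^ n) • c = c := by
      rw [map_pow]
      exact (MulAction.stabilizer (GL (Fin 2) ℝ) c).pow_mem hsc n
    rw [← map_pow] at hmem
    obtain ⟨z, hz⟩ := Subgroup.mem_zpowers_iff.1 ((hc.stabilizer _).1 ⟨hmem.1, hfix⟩)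
    rw [cuspGen_zpow] at hz
    obtain ⟨y, hy⟩ := eq_transl_of_pow (a := (cuspMatrix c)⁻¹ * s * cuspMatrix c) (x := z * h)
      ((fixes_iff c s).1 hsc) hn (by
        have h1 : ((cuspMatrix c)⁻¹ * s * cuspMatrix c) ^ n =
            (cuspMatrix c)⁻¹ * s ^ n * cuspMatrix c := by
          simpa using conj_pow (i := n) (a := (cuspMatrix c)⁻¹) (b := s)
        rw [h1, map_mul, map_mul, ← hz, cuspGen, map_mul, map_mul, map_inv]
        group)
    refine ⟨y, ?_⟩
    rw [cuspGen, map_mul, map_mul, ← hy, map_mul, map_mul, map_inv]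
    group
  let S : AddSubgroup ℝ :=
    { carrier := {x | cuspGen c x ∈ G}
      add_mem' := fun {x y} hx hy => by
        change cuspGen c (x + y) ∈ G
        rw [cuspGen_add]
        exact G.mul_mem hx hy
      zero_mem' := by
        change cuspGen c 0 ∈ G
        have h1 : cuspGen c 0 = 1 := by simp [cuspGen, transl_zero]
        rw [h1]
        exact G.one_mem
      neg_mem' := fun {x} hx => by
        have h1 := cuspGen_zpow c x (-1)
        have h2 : ((-1 : ℤ) : ℝ) * x = -x := by simp
        rw [h2] at h1
        change cuspGen c (-x) ∈ G
        rw [← h1]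
        exact G.zpow_mem hx (-1) }
  have hSh : h ∈ S := hHG hc.mem
  set N : ℕ := (H.relIndex G).factorial with hN
  have hNpos : (0 : ℝ) < N := by exact_mod_cast Nat.factorial_pos _
  have hS : ∀ x ∈ S, ∃ z : ℤ, N * x = z * h := by
    intro x hx
    obtain ⟨n, hn, hle, hmem⟩ := Subgroup.exists_pow_mem_of_relIndex_ne_zero hfin hx
    obtain ⟨j, hj⟩ := Nat.dvd_factorial hn hle
    have h1 : cuspGen c ((n : ℤ) * x) ∈ H := by
      rw [← cuspGen_zpow, zpow_natCast]
      exact hmem.1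
    obtain ⟨z, hz⟩ := key _ h1
    refine ⟨j * z, ?_⟩
    rw [hN, hj]
    push_cast at hz ⊢
    linear_combination (j : ℝ) * hz
  obtain ⟨b, hb⟩ := AddSubgroup.cyclic_of_isolated_zero (H := S) (a := h / N)
    (div_pos hc.pos hNpos) (by
      rw [Set.disjoint_left]
      rintro x hx ⟨hx0, hx1⟩
      obtain ⟨z, hz⟩ := hS x hx
      rw [lt_div_iff₀ hNpos, mul_comm, hz] at hx1
      have h0 : 0 < (z : ℝ) * h := by rw [← hz]; positivity
      have hz0 : (0 : ℝ) < z := pos_of_mul_pos_left h0 hc.pos.le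
      have hz1 : (z : ℝ) < 1 := by
        by_contra hcon
        nlinarith [hc.pos]
      have hz0' : (0 : ℤ) < z := by exact_mod_cast hz0
      have hz1' : z < (1 : ℤ) := by exact_mod_cast hz1
      omega)
  have hmemS : ∀ x, x ∈ S ↔ ∃ z : ℤ, x = z * |b| := by
    intro x
    rw [hb, AddSubgroup.mem_closure_singleton]
    rcases abs_choice b with h1 | h1 <;> rw [h1]
    · constructor
      · rintro ⟨z, rfl⟩
        exact ⟨z, by simp⟩
      · rintro ⟨z, rfl⟩
        exact ⟨z, by simp⟩
    · constructor
      · rintro ⟨z, rfl⟩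
        exact ⟨-z, by simp⟩
      · rintro ⟨z, rfl⟩
        exact ⟨-z, by simp⟩
  obtain ⟨l, hl⟩ := (hmemS h).1 hSh
  have hl0 : 0 < (l : ℝ) * |b| := hl ▸ hc.pos
  have hlpos : 0 < (l : ℝ) := pos_of_mul_pos_left hl0 (abs_nonneg b)
  have hbpos : 0 < |b| := pos_of_mul_pos_right hl0 hlpos.le
  have hlpos' : (0 : ℤ) < l := by exact_mod_cast hlpos
  have hbS : cuspGen c |b| ∈ G := (hmemS |b|).2 ⟨1, by simp⟩
  refine ⟨|b|, l.toNat, by omega, ⟨hbpos, fun s => ⟨?_, ?_⟩⟩, ?_⟩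
  · rintro ⟨hsG, hsc⟩
    obtain ⟨x, hx⟩ := claim s hsG hsc
    rw [hx] at hsG ⊢
    obtain ⟨z, rfl⟩ := (hmemS x).1 hsG
    exact Subgroup.mem_zpowers_iff.2 ⟨z, cuspGen_zpow c _ z⟩
  · intro hs
    obtain ⟨z, hz⟩ := Subgroup.mem_zpowers_iff.1 hs
    refine ⟨hz ▸ G.zpow_mem hbS z, ?_⟩
    rw [cuspGen_zpow] at hz
    exact fixes_of_toPSL_eq_cuspGen hz.symm
  · rw [hl]
    congr 1
    have : ((l.toNat : ℤ) : ℝ) = (l : ℝ) := by rw [Int.toNat_of_nonneg hlpos'.le]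
    exact_mod_cast this.symm

/-- Modular functions of `G` are modular functions of its subgroups of finite index. -/
theorem modularFunctionRing_le {G H : Subgroup PSL(2, ℝ)} (hHG : H ≤ G)
    (hfin : H.relIndex G ≠ 0) : modularFunctionRing G ≤ modularFunctionRing H := by
  intro f hf
  obtain ⟨f1, f2, f3⟩ := isModularFunction_iff.1 hf
  refine isModularFunction_iff.2 ⟨f1, fun s hs => f2 s (hHG hs), fun c h hc => ?_⟩
  obtain ⟨k, l, hl, hk, rfl⟩ := hc.of_le hHG hfin
  obtain ⟨M, a, hS⟩ := f3 c k hk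
  have hinj : Function.Injective fun n : ℕ => l * n := fun _ _ h => Nat.eq_of_mul_eq_mul_left hl h
  refine ⟨l * M, Function.extend (fun n : ℕ => l * n) a 0, fun τ => ?_⟩
  refine (hinj.hasSum_iff ?_).1 ?_
  · intro n hn
    rw [Function.extend_apply' _ _ _ (by simpa using hn)]
    simp
  · have hq : localParam c k τ = localParam c (l * k) τ ^ l := by
      rw [localParam, localParam, ← Complex.exp_nat_mul]
      congr 1
      have hk0 : (k : ℂ) ≠ 0 := by exact_mod_cast hk.pos.ne'
      have hl0 : (l : ℂ) ≠ 0 := by exact_mod_cast hl.ne'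
      push_cast
      field_simp
    refine HasSum.congr_fun (hS τ) fun n => ?_
    simp only [Function.comp_apply]
    rw [hinj.extend_apply a 0 n, hq, ← zpow_natCast, ← _root_.zpow_mul]
    congr 2
    push_cast
    ring

/-! ### Induced representations -/

/-- `γ_1, …, γ_m` is a complete system of representatives of the left cosets of `H` in `G`:
`G` is the disjoint union of the cosets `γ_i H`. -/
structure IsCosetReps (G H : Subgroup PSL(2, ℝ)) {m : ℕ} (γ : Fin m → PSL(2, ℝ)) : Prop where
  mem : ∀ i, γ i ∈ G
  existsUnique : ∀ x ∈ G, ∃! i, (γ i)⁻¹ * x ∈ H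

section Ind

variable {ι : Type*} [Fintype ι] [DecidableEq ι]

open Classical in
/-- The extension of `ρ : H → GL_d(ℂ)` by zero to a matrix-valued function. -/
def extendByZero {H : Subgroup PSL(2, ℝ)} (ρ : H →* GL ι ℂ) (x : PSL(2, ℝ)) : Matrix ι ι ℂ :=
  if hx : x ∈ H then (ρ ⟨x, hx⟩ : Matrix ι ι ℂ) else 0

/-- The block matrix `(ρ(γ_i⁻¹ x γ_j))_{i, j}`. -/
def indMatrix {H : Subgroup PSL(2, ℝ)} (ρ : H →* GL ι ℂ) {m : ℕ} (γ : Fin m → PSL(2, ℝ))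
    (x : PSL(2, ℝ)) : Matrix (Fin m × ι) (Fin m × ι) ℂ :=
  Matrix.of fun p q => extendByZero ρ ((γ p.1)⁻¹ * x * γ q.1) p.2 q.2

theorem extendByZero_mul {H : Subgroup PSL(2, ℝ)} (ρ : H →* GL ι ℂ) (u v : PSL(2, ℝ))
    (hv : v ∈ H) : extendByZero ρ u * extendByZero ρ v = extendByZero ρ (u * v) := by
  by_cases hu : u ∈ H
  · have h1 : (⟨u * v, H.mul_mem hu hv⟩ : H) = ⟨u, hu⟩ * ⟨v, hv⟩ := rfl
    rw [extendByZero, extendByZero, extendByZero, dif_pos hu, dif_pos hv,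
      dif_pos (H.mul_mem hu hv), h1, map_mul, Units.val_mul]
  · have h1 : u * v ∉ H := fun h => hu ((H.mul_mem_cancel_right hv).1 h)
    rw [extendByZero, extendByZero, extendByZero, dif_neg hu, dif_neg h1, zero_mul]

theorem indMatrix_mul {G H : Subgroup PSL(2, ℝ)} (ρ : H →* GL ι ℂ) {m : ℕ}
    {γ : Fin m → PSL(2, ℝ)} (hγ : IsCosetReps G H γ) (x y : PSL(2, ℝ)) (hy : y ∈ G) :
    indMatrix ρ γ (x * y) = indMatrix ρ γ x * indMatrix ρ γ y := by
  ext ⟨i, a⟩ ⟨j, b⟩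
  obtain ⟨k, hk, huniq⟩ := hγ.existsUnique (y * γ j) (G.mul_mem hy (hγ.mem j))
  simp only at hk huniq
  rw [Matrix.mul_apply, Fintype.sum_prod_type, Finset.sum_eq_single k]
  · have h1 := extendByZero_mul ρ ((γ i)⁻¹ * x * γ k) ((γ k)⁻¹ * y * γ j) (by
      rwa [mul_assoc])
    have h2 : (γ i)⁻¹ * x * γ k * ((γ k)⁻¹ * y * γ j) = (γ i)⁻¹ * (x * y) * γ j := by group
    rw [h2] at h1
    simp only [indMatrix, Matrix.of_apply]
    rw [← h1, Matrix.mul_apply]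
  · intro l _ hl
    refine Finset.sum_eq_zero fun c _ => ?_
    have h1 : (γ l)⁻¹ * y * γ j ∉ H := fun h => hl (huniq l (by rwa [← mul_assoc]))
    simp only [indMatrix, Matrix.of_apply]
    rw [extendByZero, extendByZero, dif_neg h1]
    simp
  · simp

theorem indMatrix_one {G H : Subgroup PSL(2, ℝ)} (ρ : H →* GL ι ℂ) {m : ℕ}
    {γ : Fin m → PSL(2, ℝ)} (hγ : IsCosetReps G H γ) : indMatrix ρ γ 1 = 1 := by
  ext ⟨i, a⟩ ⟨j, b⟩
  simp only [indMatrix, Matrix.of_apply, mul_one]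
  by_cases hij : i = j
  · subst hij
    have h1 : (⟨1, H.one_mem⟩ : H) = 1 := rfl
    rw [inv_mul_cancel, extendByZero, dif_pos H.one_mem, h1, map_one, Units.val_one]
    simp [Matrix.one_apply]
  · have h1 : (γ i)⁻¹ * γ j ∉ H := fun h =>
      hij ((hγ.existsUnique (γ j) (hγ.mem j)).unique h (by simp))
    rw [extendByZero, dif_neg h1]
    simp [hij]

/-- The induced representation `Ind_H^G ρ` of `G` of rank `d m`, in block form with respect to the
coset representatives `γ`: the `(i, j)` block of the matrix of `x` is `ρ(γ_i⁻¹ x γ_j)`. -/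
def indRep {G H : Subgroup PSL(2, ℝ)} (ρ : H →* GL ι ℂ) {m : ℕ} {γ : Fin m → PSL(2, ℝ)}
    (hγ : IsCosetReps G H γ) : G →* GL (Fin m × ι) ℂ :=
  MonoidHom.toHomUnits
    { toFun := fun x => indMatrix ρ γ x
      map_one' := indMatrix_one ρ hγ
      map_mul' := fun x y => indMatrix_mul ρ hγ x y y.2 }

end Ind

end VVMF

open VVMF

/-! In terms of the weight `w` slash action the map is `X ↦ (X|γ_i⁻¹)_i`, and the functional
equations are formal. For `x ∈ G` and each `i` there is exactly one `k` with `u = γ_i⁻¹ x γ_k ∈ H`,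
and then `X|γ_i⁻¹ x = X|u γ_k⁻¹ = ρ(u) X|γ_k⁻¹`, which is row `i` of the induced representation
(`indRep_mulVec`). Conversely, the `i`-th block of `Y|γ_i` is a form for `H`, because `γ_i x γ_i⁻¹`
with `x ∈ H` has `(i, i)` block `ρ(x)`; this inverts the map.

The analytic content is the cusp condition. It is replaced by a condition without exponents: `X|A_c`
grows at most exponentially in `Im τ` on vertical strips. A convergent expansion implies this
growth. Conversely, once the multiplier is removed by `q^(-Λ)`, a periodic holomorphic function of
such growth becomes bounded at `i∞` after multiplication by a power of `q`, so it has a Laurent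
expansion. Growth is stable under constant matrices, under passage to blocks and under upper
triangular substitutions. Since `G` and `H` have the same cusps and `G` permutes them, it passes
between `X` and `Y`.

Admissibility of the induced representation: some power `t_c^N` lies in every `γ_i H γ_i⁻¹`, so its
matrix is block diagonal with diagonalizable blocks, and an invertible complex matrix with a
diagonalizable power is diagonalizable (`exists_diagonal_exp_of_pow`). -/

namespace VVMF

/-! ### The automorphy factor and the slash action -/

section Slash

variable {ι : Type*}

theorem autFactor_ne_zero (s : SL(2, ℝ)) (τ : ℍ) : autFactor s τ ≠ 0 :=
  denom_ne_zero (Matrix.SpecialLinearGroup.toGL s) τ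

theorem autFactor_mul (s t : SL(2, ℝ)) (τ : ℍ) :
    autFactor (s * t) τ = autFactor s (t • τ) * autFactor t τ := by
  have ht : autFactor t τ ≠ 0 := autFactor_ne_zero t τ
  have h1 : ((t • τ : ℍ) : ℂ) * autFactor t τ = (t 0 0 : ℂ) * (τ : ℂ) + (t 0 1 : ℂ) := by
    rw [UpperHalfPlane.coe_specialLinearGroup_apply]
    exact div_mul_cancel₀ _ ht
  have h2 : autFactor s (t • τ) * autFactor t τ =
      (s 1 0 : ℂ) * (((t • τ : ℍ) : ℂ) * autFactor t τ) + (s 1 1 : ℂ) * autFactor t τ := by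
    rw [autFactor]
    ring
  rw [h2, h1]
  simp only [autFactor, Matrix.SpecialLinearGroup.coe_mul, Matrix.mul_apply, Fin.sum_univ_two]
  push_cast
  ring

theorem autFactor_one (τ : ℍ) : autFactor 1 τ = 1 := by simp [autFactor]

theorem autFactor_neg (s : SL(2, ℝ)) (τ : ℍ) : autFactor (-s) τ = -autFactor s τ := by
  simp [autFactor]
  ring

/-- The weight `w` slash action of `SL(2, ℝ)` on vector-valued functions on `ℍ`. -/
def slash (w : ℤ) (s : SL(2, ℝ)) (X : ℍ → ι → ℂ) : ℍ → ι → ℂ :=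
  fun τ => autFactor s τ ^ (-w) • X (s • τ)

/-- The cocycle relation for `autFactor` makes `slash` a right action. Working with matrices in
`SL(2, ℝ)` instead of classes in `PSL(2, ℝ)`, this holds for every integer `w`. -/
theorem slash_mul (w : ℤ) (s t : SL(2, ℝ)) (X : ℍ → ι → ℂ) :
    slash w (s * t) X = slash w t (slash w s X) := by
  funext τ
  simp only [slash, autFactor_mul, mul_smul, mul_zpow]
  rw [smul_comm]

theorem slash_one (w : ℤ) (X : ℍ → ι → ℂ) : slash w 1 X = X := by
  funext τ
  simp [slash, autFactor_one]

/-- The two lifts of an element of `PSL(2, ℝ)` differ by a sign, which an even power of the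
automorphy factor does not see. This is the point where the parity of `w` enters. -/
theorem slash_congr {w : ℤ} (hw : Even w) {s t : SL(2, ℝ)} (hst : toPSL s = toPSL t)
    (X : ℍ → ι → ℂ) : slash w s X = slash w t X := by
  funext τ
  have h1 : s • τ = t • τ := by rw [← toPSL_smul, hst, toPSL_smul]
  have h2 : autFactor s τ ^ (-w) = autFactor t τ ^ (-w) := by
    rcases toPSL_eq_iff.1 hst with rfl | rfl
    · rfl
    · rw [autFactor_neg, hw.neg.neg_zpow]
  simp only [slash, h1, h2]

theorem slash_mulVec [Fintype ι] {κ : Type*} (w : ℤ) (s : SL(2, ℝ)) (A : Matrix κ ι ℂ)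
    (X : ℍ → ι → ℂ) : slash w s (fun τ => A *ᵥ X τ) = fun τ => A *ᵥ slash w s X τ := by
  funext τ
  simp only [slash, mulVec_smul]

theorem slash_transl (w : ℤ) (h : ℝ) (X : ℍ → ι → ℂ) (τ : ℍ) :
    slash w (transl h) X τ = X (h +ᵥ τ) := by
  have h1 : transl h • τ = h +ᵥ τ := by
    ext
    rw [UpperHalfPlane.coe_specialLinearGroup_apply]
    simp [coe_transl, add_comm]
  simp [slash, h1, autFactor, coe_transl]

theorem mdifferentiable_slash {w : ℤ} (s : SL(2, ℝ)) {X : ℍ → ι → ℂ}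
    (hX : ∀ i, MDifferentiable 𝓘(ℂ) 𝓘(ℂ) fun τ => X τ i) (i : ι) :
    MDifferentiable 𝓘(ℂ) 𝓘(ℂ) fun τ => slash w s X τ i :=
  (mdifferentiable_denom_zpow (Matrix.SpecialLinearGroup.toGL s) (-w)).mul
    ((hX i).comp (mdifferentiable_smul (g := Matrix.SpecialLinearGroup.toGL s) (by simp)))

end Slash

/-! ### Exponential growth at `∞` -/

section Growth

variable {ι : Type*} [Fintype ι]

/-- `F` grows at most exponentially with the imaginary part, on each vertical strip. -/
def ExpGrowth (F : ℍ → ι → ℂ) : Prop :=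
  ∀ R : ℝ, ∃ Y B C : ℝ, ∀ τ : ℍ, |τ.re| ≤ R → Y ≤ τ.im → ‖F τ‖ ≤ B * Real.exp (C * τ.im)

theorem ExpGrowth.mulVec {κ : Type*} [Fintype κ] {F : ℍ → ι → ℂ} (hF : ExpGrowth F)
    (A : Matrix κ ι ℂ) : ExpGrowth fun τ => A *ᵥ F τ := by
  intro R
  obtain ⟨Y, B, C, h⟩ := hF R
  let L := LinearMap.toContinuousLinearMap (Matrix.mulVecLin A)
  refine ⟨Y, ‖L‖ * B, C, fun τ h1 h2 => (L.le_opNorm (F τ)).trans ?_⟩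
  rw [mul_assoc]
  exact mul_le_mul_of_nonneg_left (h τ h1 h2) (norm_nonneg _)

/-- The modulus of `exp (α τ)` is at most `exp (‖α‖ (|Re τ| + Im τ))`. For non-real `α / i` it is
unbounded horizontally, which is why growth is only required on strips. -/
theorem ExpGrowth.exp_mul {F : ℍ → ι → ℂ} (hF : ExpGrowth F) (α : ι → ℂ) :
    ExpGrowth fun τ i => Complex.exp (α i * τ) * F τ i := by
  intro R
  obtain ⟨Y, B, C, h⟩ := hF R
  refine ⟨Y, Real.exp (‖α‖ * R) * B, ‖α‖ + C, fun τ h1 h2 => ?_⟩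
  have h3 : ∀ i, ‖Complex.exp (α i * τ)‖ ≤ Real.exp (‖α‖ * R) * Real.exp (‖α‖ * τ.im) := by
    intro i
    rw [Complex.norm_exp, ← Real.exp_add, Real.exp_le_exp, ← mul_add]
    calc (α i * τ).re ≤ ‖α i * τ‖ := Complex.re_le_norm _
      _ = ‖α i‖ * ‖(τ : ℂ)‖ := norm_mul _ _
      _ ≤ ‖α‖ * (R + τ.im) := by
        gcongr
        · exact norm_le_pi_norm α i
        · refine (Complex.norm_le_abs_re_add_abs_im _).trans (add_le_add h1 ?_)
          exact (abs_of_pos τ.im_pos).le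
  have h4 := h τ h1 h2
  have h5 : 0 ≤ B * Real.exp (C * τ.im) := (norm_nonneg _).trans h4
  have h6 : Real.exp (‖α‖ * R) * B * Real.exp ((‖α‖ + C) * τ.im) =
      Real.exp (‖α‖ * R) * Real.exp (‖α‖ * τ.im) * (B * Real.exp (C * τ.im)) := by
    rw [add_mul, Real.exp_add]
    ring
  rw [h6]
  refine (pi_norm_le_iff_of_nonneg (by positivity)).2 fun i => ?_
  rw [norm_mul]
  exact mul_le_mul (h3 i) ((norm_le_pi_norm _ i).trans h4) (norm_nonneg _) (by positivity)

theorem ExpGrowth.of_blocks {κ : Type*} [Fintype κ] {F : ℍ → κ × ι → ℂ}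
    (hF : ∀ k, ExpGrowth fun τ i => F τ (k, i)) : ExpGrowth F := by
  intro R
  choose Y B C h using fun k => hF k R
  -- Sums of absolute values dominate the constants of all blocks at once, also when there are no
  -- blocks.
  refine ⟨∑ k, |Y k|, ∑ k, |B k|, ∑ k, |C k|, fun τ h1 h2 => ?_⟩
  have hle : ∀ (f : κ → ℝ) k, f k ≤ ∑ k, |f k| := fun f k =>
    (le_abs_self _).trans
      (Finset.single_le_sum (f := fun k => |f k|) (fun _ _ => abs_nonneg _) (Finset.mem_univ k))
  have hB : 0 ≤ ∑ k, |B k| := Finset.sum_nonneg fun _ _ => abs_nonneg _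
  refine (pi_norm_le_iff_of_nonneg (by positivity)).2 fun ⟨k, i⟩ => ?_
  calc ‖F τ (k, i)‖ ≤ ‖fun i => F τ (k, i)‖ := norm_le_pi_norm (fun i => F τ (k, i)) i
    _ ≤ B k * Real.exp (C k * τ.im) := h k τ h1 ((hle Y k).trans h2)
    _ ≤ _ := by
      gcongr
      · exact hle B k
      · exact hle C k

theorem ExpGrowth.block {κ : Type*} [Fintype κ] {F : ℍ → κ × ι → ℂ} (hF : ExpGrowth F) (k : κ) :
    ExpGrowth fun τ i => F τ (k, i) := by
  intro R
  obtain ⟨Y, B, C, h⟩ := hF R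
  refine ⟨Y, B, C, fun τ h1 h2 => ?_⟩
  have h3 := h τ h1 h2
  exact (pi_norm_le_iff_of_nonneg ((norm_nonneg _).trans h3)).2 fun i =>
    (norm_le_pi_norm (F τ) (k, i)).trans h3

/-- With diagonal entries `a`, `a⁻¹` and upper entry `b`, such a matrix acts by `τ ↦ a² τ + a b` and
has the constant automorphy factor `a⁻¹`. Strips go into strips, and imaginary parts are only
rescaled. -/
theorem ExpGrowth.slash {F : ℍ → ι → ℂ} (hF : ExpGrowth F) (w : ℤ) {s : SL(2, ℝ)}
    (hs : s 1 0 = 0) : ExpGrowth (slash w s F) := by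
  intro R
  have hdet : s 0 0 * s 1 1 = 1 := by
    have := s.det_coe
    rw [Matrix.det_fin_two] at this
    simpa [hs] using this
  set a := s 0 0 with ha
  set b := s 0 1 with hb
  have ha0 : a ≠ 0 := left_ne_zero_of_mul_eq_one hdet
  have hd : s 1 1 = a⁻¹ := eq_inv_of_mul_eq_one_right hdet
  have hcoe : ∀ τ : ℍ, ((s • τ : ℍ) : ℂ) = ((a ^ 2 : ℝ) : ℂ) * τ + ((a * b : ℝ) : ℂ) := by
    intro τ
    have ha0' : (a : ℂ) ≠ 0 := by exact_mod_cast ha0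
    rw [UpperHalfPlane.coe_specialLinearGroup_apply]
    simp only [hs, hd, ← ha, ← hb, Algebra.algebraMap_self, RingHom.id_apply]
    push_cast
    field_simp
    simp
  have hre : ∀ τ : ℍ, (s • τ).re = a ^ 2 * τ.re + a * b := by
    intro τ
    have := congrArg Complex.re (hcoe τ)
    rwa [Complex.add_re, Complex.re_ofReal_mul, Complex.ofReal_re] at this
  have him : ∀ τ : ℍ, (s • τ).im = a ^ 2 * τ.im := by
    intro τ
    have := congrArg Complex.im (hcoe τ)
    rwa [Complex.add_im, Complex.im_ofReal_mul, Complex.ofReal_im, add_zero] at this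
  obtain ⟨Y, B, C, h⟩ := hF (a ^ 2 * R + |a * b|)
  refine ⟨Y / a ^ 2, ‖((a⁻¹ : ℝ) : ℂ) ^ (-w)‖ * B, C * a ^ 2, fun τ h1 h2 => ?_⟩
  have hj : autFactor s τ = ((a⁻¹ : ℝ) : ℂ) := by simp [autFactor, hs, hd]
  have h3 := h (s • τ) (by
    rw [hre]
    refine (abs_add_le _ _).trans (add_le_add_left ?_ _)
    rw [abs_mul, abs_of_nonneg (sq_nonneg a)]
    exact mul_le_mul_of_nonneg_left h1 (sq_nonneg a)) (by
    rw [him]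
    rwa [div_le_iff₀' (by positivity)] at h2)
  rw [him, ← mul_assoc] at h3
  rw [VVMF.slash, norm_smul, hj, mul_assoc]
  exact mul_le_mul_of_nonneg_left h3 (norm_nonneg _)

end Growth

/-! ### Expansions at a cusp versus exponential growth -/

section CuspExpansion

variable {ι : Type*} [Fintype ι]

theorem localParam_cuspMatrix_smul (c : OnePoint ℝ) (h : ℝ) (τ : ℍ) :
    localParam c h (cuspMatrix c • τ) = Function.Periodic.qParam h τ := by
  rw [localParam, inv_smul_smul, Function.Periodic.qParam]

/-- Absolute convergence at the single point `i` suffices. If `Im τ ≥ 1`, then `|q(τ)| ≤ r =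
|q(i)|`, so the terms at `τ` are at most `|q|^(-M) r^M` times those at `i`, and `|q|^(-M)` is an
exponential in `Im τ`. -/
theorem expGrowth_of_hasSum {T : ℍ → ι → ℂ} {h : ℝ} (hh : 0 < h) {M : ℤ} {a : ℕ → ι → ℂ}
    (hT : ∀ τ : ℍ, HasSum (fun n : ℕ => Function.Periodic.qParam h τ ^ ((n : ℤ) - M) • a n)
      (T τ)) : ExpGrowth T := by
  intro R
  set r : ℝ := ‖Function.Periodic.qParam h (UpperHalfPlane.I : ℍ)‖ with hr
  have hr0 : 0 < r := norm_pos_iff.2 (Function.Periodic.qParam_ne_zero _)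
  have hsum : Summable fun n : ℕ => r ^ ((n : ℤ) - M) * ‖a n‖ := by
    have := (hT UpperHalfPlane.I).summable.norm
    simpa only [norm_smul, norm_zpow] using this
  refine ⟨1, r ^ M * ∑' n : ℕ, r ^ ((n : ℤ) - M) * ‖a n‖, 2 * Real.pi * M / h,
    fun τ _ hτ => ?_⟩
  set q := Function.Periodic.qParam h τ with hq
  have hq0 : 0 < ‖q‖ := norm_pos_iff.2 (Function.Periodic.qParam_ne_zero _)
  have hqr : ‖q‖ ≤ r := by
    rw [hq, hr, Function.Periodic.norm_qParam, Function.Periodic.norm_qParam, Real.exp_le_exp]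
    refine div_le_div_of_nonneg_right ?_ hh.le
    have : (1 : ℝ) ≤ (τ : ℂ).im := hτ
    simp only [UpperHalfPlane.coe_I, Complex.I_im]
    nlinarith [Real.pi_pos]
  have hqM : ‖q‖ ^ (-M) = Real.exp (2 * Real.pi * M / h * τ.im) := by
    rw [hq, Function.Periodic.norm_qParam, ← Real.rpow_intCast, ← Real.exp_mul]
    congr 1
    push_cast
    rw [UpperHalfPlane.coe_im]
    ring
  rw [← hqM]
  have hbound : ∀ n : ℕ, ‖q ^ ((n : ℤ) - M) • a n‖ ≤
      ‖q‖ ^ (-M) * r ^ M * (r ^ ((n : ℤ) - M) * ‖a n‖) := by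
    intro n
    rw [norm_smul, norm_zpow, sub_eq_neg_add, zpow_add₀ hq0.ne', zpow_natCast]
    have h1 : r ^ M * r ^ (-M + n) = r ^ n := by
      rw [← zpow_add₀ hr0.ne', ← zpow_natCast]
      congr 1
      ring
    calc ‖q‖ ^ (-M) * ‖q‖ ^ n * ‖a n‖ ≤ ‖q‖ ^ (-M) * r ^ n * ‖a n‖ := by gcongr
      _ = _ := by
        rw [← h1]
        ring
  have := tsum_of_norm_bounded (hsum.hasSum.mul_left _) hbound
  rw [(hT τ).tsum_eq] at this
  linarith

/-- A periodic holomorphic function of at most exponential growth has a Laurent expansion in the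
local parameter. -/
theorem ExpGrowth.exists_hasSum {F : ℍ → ι → ℂ} (hF : ExpGrowth F) {h : ℝ} (hh : 0 < h)
    (hper : ∀ τ : ℍ, F (h +ᵥ τ) = F τ)
    (hhol : ∀ i, MDifferentiable 𝓘(ℂ) 𝓘(ℂ) fun τ => F τ i) :
    ∃ (M : ℤ) (a : ℕ → ι → ℂ), ∀ τ : ℍ,
      HasSum (fun n : ℕ => Function.Periodic.qParam h τ ^ ((n : ℤ) - M) • a n) (F τ) := by
  obtain ⟨Y, B, C, hB⟩ := hF h
  -- Periodicity moves any point into `0 ≤ Re < h`, so the bound on one strip holds for all real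
  -- parts.
  have hB' : ∀ τ : ℍ, Y ≤ τ.im → ‖F τ‖ ≤ B * Real.exp (C * τ.im) := by
    intro τ hτ
    have hp : Function.Periodic (fun x : ℝ => F (x +ᵥ τ)) h := by
      intro x
      simp only
      rw [add_comm, add_vadd, hper]
    obtain ⟨x, hx, hx'⟩ := hp.exists_mem_Ico hh 0 (-τ.re)
    simp only [zero_vadd] at hx'
    rw [hx']
    have := hB (x +ᵥ τ) (by
      rw [UpperHalfPlane.vadd_re, abs_le]
      constructor <;> linarith [hx.1, hx.2]) (by rwa [UpperHalfPlane.vadd_im])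
    rwa [UpperHalfPlane.vadd_im] at this
  -- For this `M` the decay of `|q^M| = exp (-2π M Im τ / h)` absorbs `exp (C Im τ)`. Thus `q^M F`
  -- is bounded at `i∞` and has a power series in `q`; dividing by `q^M` gives the Laurent series.
  obtain ⟨M, hM⟩ := exists_nat_ge (C * h / (2 * Real.pi))
  have hM' : C ≤ 2 * Real.pi * M / h := by
    rw [div_le_iff₀ (by positivity)] at hM
    rw [le_div_iff₀ hh]
    linarith
  let f : ι → ℍ → ℂ := fun i τ => Function.Periodic.qParam h τ ^ M * F τ i
  have hq : ∀ τ : ℍ, Function.Periodic.qParam h ((h +ᵥ τ : ℍ) : ℂ) =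
      Function.Periodic.qParam h τ := by
    intro τ
    have hh0 : (h : ℂ) ≠ 0 := by exact_mod_cast hh.ne'
    rw [UpperHalfPlane.coe_vadd, Function.Periodic.qParam, Function.Periodic.qParam, mul_add,
      add_div, mul_div_cancel_right₀ _ hh0, add_comm, Complex.exp_periodic]
  have f1 : ∀ i, Function.Periodic (f i ∘ UpperHalfPlane.ofComplex) h := by
    intro i z
    by_cases hz : 0 < z.im
    · have hz' : 0 < (z + h).im := by simpa using hz
      have h1 : (⟨z + h, hz'⟩ : ℍ) = h +ᵥ (⟨z, hz⟩ : ℍ) := by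
        ext
        simp [add_comm]
      simp only [Function.comp_apply, ofComplex_apply_of_im_pos hz, ofComplex_apply_of_im_pos hz',
        f]
      rw [h1, hper, ← hq ⟨z, hz⟩, ← h1]
    -- Outside the upper half plane `ofComplex` takes one constant default value, so periodicity
    -- holds there too.
    · have hz' : (z + h).im ≤ 0 := by simpa using hz
      simp only [Function.comp_apply, ofComplex_apply_of_im_nonpos (not_lt.1 hz),
        ofComplex_apply_of_im_nonpos hz']
  have f2 : ∀ i, MDifferentiable 𝓘(ℂ) 𝓘(ℂ) (f i) := by
    intro i
    refine MDifferentiable.mul ?_ (hhol i)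
    exact (((Function.Periodic.differentiable_qParam (h := h)).pow M).mdifferentiable).comp
      mdifferentiable_coe
  have f3 : ∀ i, IsBoundedAtImInfty (f i) := by
    intro i
    rw [isBoundedAtImInfty_iff]
    refine ⟨|B|, Y, fun τ hτ => ?_⟩
    have h1 := (norm_le_pi_norm (F τ) i).trans (hB' τ hτ)
    have h2 : ‖Function.Periodic.qParam h τ ^ M‖ * Real.exp (C * τ.im) ≤ 1 := by
      rw [norm_pow, Function.Periodic.norm_qParam, ← Real.exp_nat_mul, ← Real.exp_add,
        Real.exp_le_one_iff]
      have h3 := mul_le_mul_of_nonneg_right hM' τ.im_pos.le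
      have h4 : (M : ℝ) * (-2 * Real.pi * (τ : ℂ).im / h) = -(2 * Real.pi * M / h * τ.im) := by
        rw [UpperHalfPlane.coe_im]
        ring
      linarith
    calc ‖f i τ‖ = ‖Function.Periodic.qParam h τ ^ M‖ * ‖F τ i‖ := norm_mul _ _
      _ ≤ ‖Function.Periodic.qParam h τ ^ M‖ * (|B| * Real.exp (C * τ.im)) := by
        gcongr
        exact h1.trans (by gcongr; exact le_abs_self B)
      _ = |B| * (‖Function.Periodic.qParam h τ ^ M‖ * Real.exp (C * τ.im)) := by ring
      _ ≤ |B| := mul_le_of_le_one_right (abs_nonneg B) h2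
  refine ⟨M, fun n i => (UpperHalfPlane.qExpansion h (f i)).coeff n, fun τ => ?_⟩
  rw [Pi.hasSum]
  intro i
  have hq0 : Function.Periodic.qParam h τ ≠ 0 := Function.Periodic.qParam_ne_zero _
  have h1 := (UpperHalfPlane.hasSum_qExpansion hh (f1 i) (f2 i) (f3 i) τ).mul_left
    (Function.Periodic.qParam h τ ^ (-(M : ℤ)))
  have h2 : Function.Periodic.qParam h τ ^ (-(M : ℤ)) * f i τ = F τ i := by
    simp only [f]
    rw [← mul_assoc, _root_.zpow_neg, zpow_natCast, inv_mul_cancel₀ (pow_ne_zero _ hq0), one_mul]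
  rw [h2] at h1
  refine HasSum.congr_fun h1 fun n => ?_
  rw [Pi.smul_apply, smul_eq_mul, smul_eq_mul, sub_eq_neg_add, zpow_add₀ hq0, zpow_natCast]
  ring

variable [DecidableEq ι]

/-- The substitution `τ ↦ A_c τ` moves the cusp to `∞`: the factors of `A_c` and `A_c⁻¹` cancel, and
the local parameter becomes the standard `qParam`. -/
theorem hasCuspExpansion_iff {w : ℤ} {X : ℍ → ι → ℂ} {c : OnePoint ℝ} {h : ℝ} {P : GL ι ℂ}
    {Λ : ι → ℂ} : HasCuspExpansion w X c h P Λ ↔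
      ∃ (M : ℤ) (a : ℕ → ι → ℂ) (T : ℍ → ι → ℂ), ∀ τ : ℍ,
        HasSum (fun n : ℕ => Function.Periodic.qParam h τ ^ ((n : ℤ) - M) • a n) (T τ) ∧
        slash w (cuspMatrix c) X τ = (P : Matrix ι ι ℂ) *ᵥ fun i =>
          Complex.exp (2 * Real.pi * Complex.I * Λ i / h * τ) *
            (((P⁻¹ : GL ι ℂ) : Matrix ι ι ℂ) *ᵥ T τ) i := by
  have key : ∀ (τ : ℍ) (v : ι → ℂ), ((P : Matrix ι ι ℂ) *
      localParamPow c h Λ (cuspMatrix c • τ) * ((P⁻¹ : GL ι ℂ) : Matrix ι ι ℂ)) *ᵥ v =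
      (P : Matrix ι ι ℂ) *ᵥ fun i => Complex.exp (2 * Real.pi * Complex.I * Λ i / h * τ) *
            (((P⁻¹ : GL ι ℂ) : Matrix ι ι ℂ) *ᵥ v) i := by
    intro τ v
    rw [← mulVec_mulVec, ← mulVec_mulVec, localParamPow]
    congr 1
    funext i
    rw [mulVec_diagonal, inv_smul_smul, div_mul_eq_mul_div]
  have haut : ∀ τ : ℍ, autFactor (cuspMatrix c)⁻¹ (cuspMatrix c • τ) *
      autFactor (cuspMatrix c) τ = 1 := by
    intro τ
    rw [← autFactor_mul, inv_mul_cancel, autFactor_one]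
  constructor
  · rintro ⟨M, a, S, hS⟩
    refine ⟨M, a, fun τ => S (cuspMatrix c • τ), fun τ => ⟨?_, ?_⟩⟩
    · simpa only [localParam_cuspMatrix_smul] using (hS (cuspMatrix c • τ)).1
    · rw [slash, (hS (cuspMatrix c • τ)).2, smul_smul, ← mul_zpow,
        mul_comm (autFactor (cuspMatrix c) τ), haut, _root_.one_zpow, one_smul, key]
  · rintro ⟨M, a, T, hT⟩
    refine ⟨M, a, fun τ => T ((cuspMatrix c)⁻¹ • τ), fun τ => ?_⟩
    obtain ⟨z, rfl⟩ : ∃ z, τ = cuspMatrix c • z := ⟨(cuspMatrix c)⁻¹ • τ, by simp⟩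
    simp only [localParam_cuspMatrix_smul, key, inv_smul_smul, ← (hT z).2]
    refine ⟨(hT z).1, ?_⟩
    rw [slash, smul_smul, ← mul_zpow, haut, _root_.one_zpow, one_smul]

theorem HasCuspExpansion.expGrowth {w : ℤ} {X : ℍ → ι → ℂ} {c : OnePoint ℝ} {h : ℝ}
    (hh : 0 < h) {P : GL ι ℂ} {Λ : ι → ℂ} (hX : HasCuspExpansion w X c h P Λ) :
    ExpGrowth (slash w (cuspMatrix c) X) := by
  obtain ⟨M, a, T, hT⟩ := hasCuspExpansion_iff.1 hX
  rw [funext fun τ => (hT τ).2]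
  exact (((expGrowth_of_hasSum hh fun τ => (hT τ).1).mulVec _).exp_mul _).mulVec _

/-- The function `F = X|A_c` satisfies `F(τ + h) = ρ(t_c) F(τ)`. In the basis given by `P` this
multiplies the `i`-th coordinate by `exp (2π i Λ_i)`, which the factor `exp (-2π i Λ_i τ / h)`
undoes. The resulting `E` is periodic, holomorphic and of exponential growth. The growth hypothesis
does not involve `P` or `Λ`, so every choice of exponent is handled. -/
theorem hasCuspExpansion_of_expGrowth {G : Subgroup PSL(2, ℝ)} {w : ℤ} {ρ : G →* GL ι ℂ}
    {X : ℍ → ι → ℂ} (hhol : ∀ i, MDifferentiable 𝓘(ℂ) 𝓘(ℂ) fun τ => X τ i)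
    (htr : ∀ (s : SL(2, ℝ)) (hs : toPSL s ∈ G),
      slash w s X = fun τ => (ρ ⟨toPSL s, hs⟩ : Matrix ι ι ℂ) *ᵥ X τ)
    {c : OnePoint ℝ} {h : ℝ} (hc : IsCuspOfWidth G c h)
    (hgr : ExpGrowth (slash w (cuspMatrix c) X)) {P : GL ι ℂ} {Λ : ι → ℂ}
    (hΛ : IsExponent ρ hc P Λ) : HasCuspExpansion w X c h P Λ := by
  set F := slash w (cuspMatrix c) X with hF
  set R : Matrix ι ι ℂ := (ρ ⟨cuspGen c h, hc.mem⟩ : Matrix ι ι ℂ) with hR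
  have hPP : (P : Matrix ι ι ℂ) * ((P⁻¹ : GL ι ℂ) : Matrix ι ι ℂ) = 1 := Units.mul_inv P
  have hPP' : ((P⁻¹ : GL ι ℂ) : Matrix ι ι ℂ) * (P : Matrix ι ι ℂ) = 1 := Units.inv_mul P
  have hFper : ∀ τ : ℍ, F (h +ᵥ τ) = R *ᵥ F τ := by
    intro τ
    rw [← slash_transl w h F, hF, ← slash_mul]
    -- That is, `A_c (1 h; 0 1) = t_c A_c`, so translation by `h` becomes the action of `t_c` on
    -- `X`.
    have h1 : cuspMatrix c * transl h =
        cuspMatrix c * transl h * (cuspMatrix c)⁻¹ * cuspMatrix c := by group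
    rw [h1, slash_mul, htr _ hc.mem, slash_mulVec]
    rfl
  have hPR : ((P⁻¹ : GL ι ℂ) : Matrix ι ι ℂ) * R =
      Matrix.diagonal (fun i => Complex.exp (2 * Real.pi * Complex.I * Λ i)) *
        ((P⁻¹ : GL ι ℂ) : Matrix ι ι ℂ) := by
    rw [← hΛ, Units.val_mul, Units.val_mul, mul_assoc, hPP, mul_one]
  let α : ι → ℂ := fun i => 2 * Real.pi * Complex.I * Λ i / h
  let E : ℍ → ι → ℂ := fun τ i =>
    Complex.exp ((-α) i * τ) * (((P⁻¹ : GL ι ℂ) : Matrix ι ι ℂ) *ᵥ F τ) i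
  have hE : ExpGrowth E := (hgr.mulVec _).exp_mul _
  have hEper : ∀ τ : ℍ, E (h +ᵥ τ) = E τ := by
    intro τ
    funext i
    have hh0 : (h : ℂ) ≠ 0 := by exact_mod_cast hc.pos.ne'
    simp only [E, hFper, mulVec_mulVec, hPR]
    rw [← mulVec_mulVec, mulVec_diagonal, ← mul_assoc, ← Complex.exp_add,
      UpperHalfPlane.coe_vadd]
    congr 2
    simp only [Pi.neg_apply, α]
    field_simp
    ring
  have hEhol : ∀ i, MDifferentiable 𝓘(ℂ) 𝓘(ℂ) fun τ => E τ i := by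
    intro i
    refine MDifferentiable.mul (p := fun τ : ℍ => Complex.exp ((-α) i * τ)) ?_ ?_
    · have : Differentiable ℂ fun z : ℂ => Complex.exp ((-α) i * z) := by fun_prop
      exact this.mdifferentiable.comp mdifferentiable_coe
    · have hFh := mdifferentiable_slash (w := w) (cuspMatrix c) hhol
      rw [UpperHalfPlane.mdifferentiable_iff]
      exact DifferentiableOn.fun_sum fun j _ =>
        ((UpperHalfPlane.mdifferentiable_iff.1 (hFh j)).const_mul _)
  obtain ⟨M, a, ha⟩ := hE.exists_hasSum hc.pos hEper hEhol
  let L := LinearMap.toContinuousLinearMap (Matrix.mulVecLin (P : Matrix ι ι ℂ))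
  -- The prescribed form is `P q^Λ P⁻¹ S` while `F = P q^Λ E`, so the series is `S = P E`.
  refine hasCuspExpansion_iff.2 ⟨M, fun n => (P : Matrix ι ι ℂ) *ᵥ a n,
    fun τ => (P : Matrix ι ι ℂ) *ᵥ E τ, fun τ => ⟨?_, ?_⟩⟩
  · have h1 := L.hasSum (ha τ)
    simp only [map_smul] at h1
    exact h1
  · rw [mulVec_mulVec, hPP', one_mulVec]
    have h1 : (fun i => Complex.exp (2 * Real.pi * Complex.I * Λ i / h * τ) * E τ i) =
        ((P⁻¹ : GL ι ℂ) : Matrix ι ι ℂ) *ᵥ F τ := by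
      funext i
      simp only [E, α, Pi.neg_apply]
      rw [← mul_assoc, ← Complex.exp_add, neg_mul, add_neg_cancel, Complex.exp_zero, one_mul]
    rw [h1, mulVec_mulVec, hPP, one_mulVec]

theorem IsWeaklyHolomorphic.slash_eq {G : Subgroup PSL(2, ℝ)} {w : ℤ} {ρ : G →* GL ι ℂ}
    {X : ℍ → ι → ℂ} (hX : IsWeaklyHolomorphic G w ρ X) {s : SL(2, ℝ)} {x : PSL(2, ℝ)} (hsx : toPSL s = x)
    (hx : x ∈ G) : slash w s X = fun τ => (ρ ⟨x, hx⟩ : Matrix ι ι ℂ) *ᵥ X τ := by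
  subst hsx
  funext τ
  rw [slash, hX.transform s hx, smul_smul, ← zpow_add₀ (autFactor_ne_zero s τ), neg_add_cancel,
    zpow_zero, one_smul]

/-- Admissibility supplies at least one exponent, without which the cusp condition would be vacuous.
The converse `of_expGrowth` does not need it. -/
theorem IsWeaklyHolomorphic.expGrowth {G : Subgroup PSL(2, ℝ)} {w : ℤ} {ρ : G →* GL ι ℂ}
    (hρ : IsAdmissible G ρ) {X : ℍ → ι → ℂ} (hX : IsWeaklyHolomorphic G w ρ X) {c : OnePoint ℝ}
    {h : ℝ} (hc : IsCuspOfWidth G c h) : ExpGrowth (slash w (cuspMatrix c) X) := by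
  obtain ⟨P, Λ, hΛ⟩ := hρ c h hc
  exact (hX.cusp c h hc P Λ hΛ).expGrowth hc.pos

theorem IsWeaklyHolomorphic.of_expGrowth {G : Subgroup PSL(2, ℝ)} {w : ℤ} {ρ : G →* GL ι ℂ}
    {X : ℍ → ι → ℂ} (hhol : ∀ i, MDifferentiable 𝓘(ℂ) 𝓘(ℂ) fun τ => X τ i)
    (htr : ∀ (s : SL(2, ℝ)) (hs : toPSL s ∈ G),
      slash w s X = fun τ => (ρ ⟨toPSL s, hs⟩ : Matrix ι ι ℂ) *ᵥ X τ)
    (hgr : ∀ (c : OnePoint ℝ) (h : ℝ), IsCuspOfWidth G c h →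
      ExpGrowth (slash w (cuspMatrix c) X)) : IsWeaklyHolomorphic G w ρ X where
  holo := hhol
  transform s hs τ := by
    rw [← congrFun (htr s hs) τ, slash, smul_smul, ← zpow_add₀ (autFactor_ne_zero s τ),
      add_neg_cancel, zpow_zero, one_smul]
  cusp c h hc _ _ hΛ := hasCuspExpansion_of_expGrowth hhol htr hc (hgr c h hc) hΛ

end CuspExpansion

/-! ### Cusps of finite-index subgroups and the action of `G` on cusps -/

section Cusps

theorem toPSL_surjective : Function.Surjective toPSL := QuotientGroup.mk'_surjective _

/-- A cusp of `G` is a cusp of every subgroup of finite index. -/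
theorem IsCuspOfWidth.exists_subgroup {G H : Subgroup PSL(2, ℝ)} (hHG : H ≤ G)
    (hfin : H.relIndex G ≠ 0) {c : OnePoint ℝ} {h : ℝ} (hc : IsCuspOfWidth G c h) :
    ∃ l : ℕ, 0 < l ∧ IsCuspOfWidth H c (l * h) := by
  -- The exponents `n` with `t_c^n ∈ H` form a subgroup `aℤ`, nonzero because the index is finite.
  -- The width in `H` is then `|a| h`.
  let S : AddSubgroup ℤ :=
    { carrier := {n | cuspGen c h ^ n ∈ H}
      add_mem' := fun {a b} ha hb => by
        change cuspGen c h ^ (a + b) ∈ H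
        rw [_root_.zpow_add]
        exact H.mul_mem ha hb
      zero_mem' := by
        change cuspGen c h ^ (0 : ℤ) ∈ H
        rw [zpow_zero]
        exact H.one_mem
      neg_mem' := fun {a} ha => by
        change cuspGen c h ^ (-a) ∈ H
        rw [_root_.zpow_neg]
        exact H.inv_mem ha }
  obtain ⟨a, ha⟩ := Int.subgroup_cyclic S
  have hS : ∀ n : ℤ, cuspGen c h ^ n ∈ H ↔ ∃ z : ℤ, n = z * a.natAbs := by
    intro n
    have h1 : n ∈ S ↔ a ∣ n := by
      rw [ha, AddSubgroup.mem_closure_singleton]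
      simp only [smul_eq_mul, eq_comm, dvd_iff_exists_eq_mul_left]
    change n ∈ S ↔ _
    rw [h1, ← Int.natAbs_dvd, dvd_iff_exists_eq_mul_left]
  have hgen : cuspGen c (a.natAbs * h) = cuspGen c h ^ (a.natAbs : ℤ) := by
    rw [cuspGen_zpow, Int.cast_natCast]
  obtain ⟨n, hn, -, hmem⟩ := Subgroup.exists_pow_mem_of_relIndex_ne_zero hfin hc.mem
  have hapos : 0 < a.natAbs := by
    rw [← zpow_natCast] at hmem
    obtain ⟨z, hz⟩ := (hS n).1 hmem.1
    refine Nat.pos_of_ne_zero fun h0 => ?_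
    rw [h0] at hz
    simp at hz
    omega
  refine ⟨a.natAbs, hapos, ⟨mul_pos (by exact_mod_cast hapos) hc.pos, fun s => ?_⟩⟩
  rw [hgen]
  constructor
  · rintro ⟨hsH, hsc⟩
    obtain ⟨n, hn⟩ := Subgroup.mem_zpowers_iff.1 ((hc.stabilizer s).1 ⟨hHG hsH, hsc⟩)
    rw [← hn] at hsH ⊢
    obtain ⟨z, rfl⟩ := (hS n).1 hsH
    exact Subgroup.mem_zpowers_iff.2 ⟨z, by rw [← _root_.zpow_mul, mul_comm]⟩
  · intro hs
    obtain ⟨z, hz⟩ := Subgroup.mem_zpowers_iff.1 hs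
    rw [← _root_.zpow_mul] at hz
    refine ⟨hz ▸ (hS _).2 ⟨z, mul_comm _ _⟩, ?_⟩
    exact ((hc.stabilizer s).2 (Subgroup.mem_zpowers_iff.2 ⟨_, hz⟩)).2

/-- The elements of `G` permute the cusps of `G`. -/
theorem IsCuspOfWidth.exists_smul {G : Subgroup PSL(2, ℝ)} {c : OnePoint ℝ} {h : ℝ}
    (hc : IsCuspOfWidth G c h) {g : SL(2, ℝ)} (hg : toPSL g ∈ G) :
    ∃ (c' : OnePoint ℝ) (h' : ℝ) (b : SL(2, ℝ)), b 1 0 = 0 ∧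
      g * cuspMatrix c = cuspMatrix c' * b ∧ IsCuspOfWidth G c' h' ∧
      toPSL g * cuspGen c h * (toPSL g)⁻¹ = cuspGen c' h' := by
  set c' : OnePoint ℝ := Matrix.SpecialLinearGroup.toGL g • c with hc'
  -- Both `g A_c` and `A_{c'}` send `∞` to `c' = g c`, so `b` fixes `∞` and is upper triangular.
  set b : SL(2, ℝ) := (cuspMatrix c')⁻¹ * g * cuspMatrix c with hb
  have hgb : g * cuspMatrix c = cuspMatrix c' * b := by
    rw [hb]
    group
  have hb0 : b 1 0 = 0 := by
    have h1 := OnePoint.smul_infty_eq_self_iff (K := ℝ) (g := Matrix.SpecialLinearGroup.toGL b)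
    refine h1.1 ?_
    rw [hb, map_mul, map_mul, mul_smul, mul_smul, toGL_cuspMatrix_smul, ← hc', map_inv,
      inv_smul_eq_iff, toGL_cuspMatrix_smul]
  have hdet : b 0 0 * b 1 1 = 1 := by
    have := b.det_coe
    rw [Matrix.det_fin_two] at this
    simpa [hb0] using this
  -- Since `b` acts as an affine map with slope `b₀₀²`, conjugation by `b` scales translations by
  -- this factor; the new width comes from here.
  have hbt : b * transl h = transl (b 0 0 ^ 2 * h) * b := by
    clear_value b
    apply Subtype.ext
    rw [Matrix.SpecialLinearGroup.coe_mul, Matrix.SpecialLinearGroup.coe_mul, coe_transl,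
      coe_transl]
    ext i j
    fin_cases i <;> fin_cases j <;> simp [Matrix.mul_apply, Fin.sum_univ_two, hb0]
    linear_combination (-(b 0 0) * h) * hdet
  have hgen : toPSL g * cuspGen c h * (toPSL g)⁻¹ = cuspGen c' (b 0 0 ^ 2 * h) := by
    rw [cuspGen, cuspGen, ← map_inv, ← map_mul, ← map_mul]
    congr 1
    calc g * (cuspMatrix c * transl h * (cuspMatrix c)⁻¹) * g⁻¹
        = (g * cuspMatrix c) * transl h * (g * cuspMatrix c)⁻¹ := by group
      _ = cuspMatrix c' * (b * transl h) * b⁻¹ * (cuspMatrix c')⁻¹ := by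
        rw [hgb]
        group
      _ = _ := by
        rw [hbt]
        group
  refine ⟨c', b 0 0 ^ 2 * h, b, hb0, hgb, ⟨?_, fun s => ?_⟩, hgen⟩
  · have : b 0 0 ≠ 0 := left_ne_zero_of_mul_eq_one hdet
    have := hc.pos
    positivity
  · have h1 := hc.stabilizer (g⁻¹ * s * g)
    have h2 : toPSL (g⁻¹ * s * g) ∈ G ↔ toPSL s ∈ G := by
      rw [map_mul, map_mul, map_inv, G.mul_mem_cancel_right hg,
        G.mul_mem_cancel_left (G.inv_mem hg)]
    have h3 : Matrix.SpecialLinearGroup.toGL (g⁻¹ * s * g) • c = c ↔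
        Matrix.SpecialLinearGroup.toGL s • c' = c' := by
      rw [map_mul, map_mul, mul_smul, mul_smul, ← hc', map_inv, inv_smul_eq_iff, ← hc']
    rw [h2, h3] at h1
    rw [h1, ← hgen, Subgroup.mem_zpowers_iff, Subgroup.mem_zpowers_iff]
    refine exists_congr fun n => ?_
    rw [conj_zpow, map_mul, map_mul, map_inv]
    constructor
    · intro h4
      rw [h4]
      group
    · intro h4
      rw [← h4]
      group

/-- Writing `g A_c = A_{c'} b` turns `X|g|A_c` into `(X|A_{c'})|b`. Here `c'` is a cusp of `G`,
hence of `H`, so growth is known at `c'`, and the upper triangular `b` preserves it. -/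
theorem IsWeaklyHolomorphic.expGrowth_slash {ι : Type*} [Fintype ι] [DecidableEq ι]
    {G H : Subgroup PSL(2, ℝ)} (hHG : H ≤ G) (hfin : H.relIndex G ≠ 0) {w : ℤ} {ρ : H →* GL ι ℂ}
    (hρ : IsAdmissible H ρ) {X : ℍ → ι → ℂ} (hX : IsWeaklyHolomorphic H w ρ X) {c : OnePoint ℝ}
    {h : ℝ} (hc : IsCuspOfWidth G c h) {g : SL(2, ℝ)} (hg : toPSL g ∈ G) :
    ExpGrowth (slash w (cuspMatrix c) (slash w g X)) := by
  obtain ⟨c', h', b, hb, hgb, hc', -⟩ := hc.exists_smul hg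
  obtain ⟨l, -, hl⟩ := hc'.exists_subgroup hHG hfin
  rw [← slash_mul, hgb, slash_mul]
  exact (hX.expGrowth hρ hl).slash w hb

end Cusps

/-! ### Diagonalizability from a diagonalizable power -/

section Diagonalizable

open Polynomial in
-- The polynomial `∏ (X^N - μ)` annihilates `f`. It is squarefree: each factor is separable because
-- `μ ≠ 0`, and factors for distinct `μ` are coprime.
theorem isSemisimple_of_aeval_pow_eq_zero {V : Type*} [AddCommGroup V] [Module ℂ V]
    {f : Module.End ℂ V} {N : ℕ} (hN : N ≠ 0) (s : Finset ℂ) (hs : (0 : ℂ) ∉ s)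
    (h : aeval (f ^ N) (∏ μ ∈ s, (X - C μ)) = 0) : f.IsSemisimple := by
  refine Module.End.isSemisimple_of_squarefree_aeval_eq_zero
    (p := ∏ μ ∈ s, (X ^ N - C μ)) ?_ ?_
  · refine Finset.squarefree_prod_of_pairwise_isCoprime ?_ ?_
    · intro μ _ ν _ hμν
      -- Coprimality of `X - μ` and `X - ν` is carried along the ring homomorphism `X ↦ X^N`.
      have h1 := (Polynomial.isCoprime_X_sub_C_of_isUnit_sub
        (sub_ne_zero.2 hμν).isUnit).map (expand ℂ N).toRingHom
      have h2 : IsCoprime (X ^ N - C μ) (X ^ N - C ν) := by simpa using h1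
      exact h2.isRelPrime
    · intro μ hμ
      refine (Polynomial.separable_X_pow_sub_C μ (by exact_mod_cast hN) ?_).squarefree
      rintro rfl
      exact hs hμ
  · have h1 : expand ℂ N (∏ μ ∈ s, (X - C μ)) = ∏ μ ∈ s, (X ^ N - C μ) := by
      rw [map_prod]
      simp
    rw [← h1, expand_aeval, h]

/-- A semisimple complex matrix is diagonalizable. -/
theorem exists_diagonal_of_isSemisimple {ι : Type*} [Fintype ι] [DecidableEq ι]
    (T : Matrix ι ι ℂ) (hT : Module.End.IsSemisimple (Matrix.toLin' T)) :
    ∃ (P : GL ι ℂ) (μ : ι → ℂ),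
      ((P⁻¹ : GL ι ℂ) : Matrix ι ι ℂ) * T * (P : Matrix ι ι ℂ) = Matrix.diagonal μ := by
  set f := Matrix.toLin' T with hf
  let S : Set (ι → ℂ) := {v | ∃ μ : ℂ, f v = μ • v}
  -- Over `ℂ` the generalized eigenspaces span, and for a semisimple map they are eigenspaces. A
  -- basis extracted from `S` therefore consists of eigenvectors.
  have hspan : ⊤ ≤ Submodule.span ℂ S := by
    rw [← Module.End.iSup_maxGenEigenspace_eq_top f]
    refine iSup_le fun μ => ?_
    rw [hT.isFinitelySemisimple.maxGenEigenspace_eq_eigenspace]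
    intro v hv
    exact Submodule.subset_span ⟨μ, Module.End.mem_eigenspace_iff.1 hv⟩
  let b₀ := Module.Basis.ofSpan hspan
  let e := b₀.indexEquiv (Pi.basisFun ℂ ι)
  let b := b₀.reindex e
  have hb : ∀ i, ∃ μ : ℂ, f (b i) = μ • b i := by
    intro i
    have h1 : b i ∈ Set.range b₀ := ⟨e.symm i, by simp [b]⟩
    exact Module.Basis.ofSpan_subset hspan h1
  choose μ hμ using hb
  let A := (Pi.basisFun ℂ ι).toMatrix b
  let B := b.toMatrix (Pi.basisFun ℂ ι)
  have hAB : A * B = 1 := (Pi.basisFun ℂ ι).toMatrix_mul_toMatrix_flip b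
  have hBA : B * A = 1 := b.toMatrix_mul_toMatrix_flip (Pi.basisFun ℂ ι)
  have hTA : T * A = A * Matrix.diagonal μ := by
    ext i j
    have h1 := congrFun (hμ j) i
    rw [hf, Matrix.toLin'_apply] at h1
    rw [Matrix.mul_diagonal]
    simp only [A, Module.Basis.toMatrix_apply, Pi.basisFun_repr, Matrix.mul_apply]
    rw [mul_comm]
    exact h1
  refine ⟨⟨A, B, hAB, hBA⟩, μ, ?_⟩
  change B * T * A = _
  rw [mul_assoc, hTA, ← mul_assoc, hBA, one_mul]

/-- An invertible complex matrix with a diagonalizable power is diagonalizable. -/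
theorem exists_diagonal_exp_of_pow {ι : Type*} [Fintype ι] [DecidableEq ι] (T Q : GL ι ℂ) {N : ℕ}
    (hN : N ≠ 0) (D : ι → ℂ)
    (h : ((Q⁻¹ * T ^ N * Q : GL ι ℂ) : Matrix ι ι ℂ) = Matrix.diagonal D) :
    ∃ (P : GL ι ℂ) (Λ : ι → ℂ), ((P⁻¹ * T * P : GL ι ℂ) : Matrix ι ι ℂ) =
      Matrix.diagonal fun i => Complex.exp (2 * Real.pi * Complex.I * Λ i) := by
  have hunit : ∀ (A : GL ι ℂ) (μ : ι → ℂ), (A : Matrix ι ι ℂ) = Matrix.diagonal μ →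
      ∀ i, μ i ≠ 0 := by
    intro A μ hA i hi
    have h1 : IsUnit (Matrix.diagonal μ) := hA ▸ A.isUnit
    rw [Matrix.isUnit_diagonal] at h1
    exact (Pi.isUnit_iff.1 h1 i).ne_zero hi
  have hss : Module.End.IsSemisimple (Matrix.toLin' (T : Matrix ι ι ℂ)) := by
    -- Taking the image as a `Finset` removes repeated eigenvalues of `T^N`; none is zero because
    -- `T` is invertible.
    refine isSemisimple_of_aeval_pow_eq_zero hN (Finset.univ.image D) ?_ ?_
    · simp only [Finset.mem_image, Finset.mem_univ, true_and, not_exists]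
      exact hunit _ D h
    · have h1 : (Matrix.toLin' (T : Matrix ι ι ℂ)) ^ N =
          Matrix.toLinAlgEquiv' ((T : Matrix ι ι ℂ) ^ N) := by
        rw [map_pow]
        rfl
      have h2 : ((T : Matrix ι ι ℂ)) ^ N =
          (Q : Matrix ι ι ℂ) * Matrix.diagonal D * ((Q⁻¹ : GL ι ℂ) : Matrix ι ι ℂ) := by
        rw [← h, ← Units.val_mul, ← Units.val_mul, ← Units.val_pow_eq_pow_val]
        congr 1
        group
      set p : Polynomial ℂ := ∏ μ ∈ Finset.univ.image D, (Polynomial.X - Polynomial.C μ) with hp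
      have h3 : ∀ i, p.eval (D i) = 0 := by
        intro i
        rw [hp, Polynomial.eval_prod]
        exact Finset.prod_eq_zero (Finset.mem_image_of_mem D (Finset.mem_univ i)) (by simp)
      have h4 : Polynomial.aeval (Matrix.diagonal D) p = 0 := by
        have h5 := Polynomial.aeval_algHom_apply (Matrix.diagonalAlgHom (n := ι) (α := ℂ) ℂ) D p
        rw [Matrix.diagonalAlgHom_apply] at h5
        rw [h5, Matrix.diagonalAlgHom_apply, ← Matrix.diagonal_zero]
        congr 1
        funext i
        rw [Polynomial.aeval_pi_apply₂]
        simpa using h3 i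
      have h6 : Polynomial.aeval ((T : Matrix ι ι ℂ) ^ N) p = 0 := by
        -- Conjugation by `Q` is an algebra automorphism, so `p(Q D Q⁻¹) = Q p(D) Q⁻¹ = 0`.
        have h7 := Polynomial.aeval_algHom_apply
          (MulSemiringAction.toAlgHom ℂ (Matrix ι ι ℂ) (ConjAct.toConjAct Q)) (Matrix.diagonal D) p
        rw [h4, map_zero, MulSemiringAction.toAlgHom_apply, ConjAct.units_smul_def,
          ConjAct.ofConjAct_toConjAct, ← h2] at h7
        exact h7
      have h8 := Polynomial.aeval_algHom_apply
        (Matrix.toLinAlgEquiv' (R := ℂ) (n := ι)) ((T : Matrix ι ι ℂ) ^ N) p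
      rw [h1, h8, h6, map_zero]
  obtain ⟨P, μ, hP⟩ := exists_diagonal_of_isSemisimple _ hss
  have hμ := hunit (P⁻¹ * T * P) μ (by simpa using hP)
  refine ⟨P, fun i => Complex.log (μ i) / (2 * Real.pi * Complex.I), ?_⟩
  rw [Units.val_mul, Units.val_mul, hP]
  congr 1
  funext i
  rw [mul_div_cancel₀ _ Complex.two_pi_I_ne_zero, Complex.exp_log (hμ i)]

end Diagonalizable

/-! ### Induced representations and induced forms -/

section Induced

/-- The vector of the functions `X|γ_i⁻¹`, for lifts `s i` of `γ_i⁻¹` to `SL(2, ℝ)`. -/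
def inducedForm {ι : Type*} {m : ℕ} (w : ℤ) (s : Fin m → SL(2, ℝ)) (X : ℍ → ι → ℂ) : ℍ → Fin m × ι → ℂ :=
  fun τ p => slash w (s p.1) X τ p.2

/-- The form for `H` that has the `i`-th block of `Y` as its slash transform under `γ_i⁻¹`. -/
def blockForm {ι : Type*} {m : ℕ} (w : ℤ) (s : Fin m → SL(2, ℝ)) (i : Fin m) (Y : ℍ → Fin m × ι → ℂ) : ℍ → ι → ℂ :=
  fun τ a => slash w (s i)⁻¹ Y τ (i, a)

/-- One component already determines `X`, because slashing by `s k` is invertible. -/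
theorem inducedForm_injective {ι : Type*} {m : ℕ} (w : ℤ) (s : Fin m → SL(2, ℝ)) (k : Fin m) :
    Function.Injective (inducedForm (ι := ι) w s) := by
  intro X X' hXX
  have h1 : slash w (s k) X = slash w (s k) X' := by
    funext τ a
    exact congrFun (congrFun hXX τ) (k, a)
  have h2 := congrArg (slash w (s k)⁻¹) h1
  rwa [← slash_mul, ← slash_mul, mul_inv_cancel, slash_one, slash_one] at h2

variable {ι : Type*} [Fintype ι] [DecidableEq ι] {G H : Subgroup PSL(2, ℝ)} {m : ℕ}
  {γ : Fin m → PSL(2, ℝ)}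

/-- Some power of the generator `t_c` is conjugated into `H`, with diagonalizable image under `ρ`,
by all coset representatives. -/
theorem exists_pow_conj_diagonal (hHG : H ≤ G) (hfin : H.relIndex G ≠ 0) {ρ : H →* GL ι ℂ}
    (hρ : IsAdmissible H ρ) (hγ : ∀ i, γ i ∈ G) {c : OnePoint ℝ} {h : ℝ}
    (hc : IsCuspOfWidth G c h) :
    ∃ N : ℕ, N ≠ 0 ∧ ∀ i, ∃ (hu : (γ i)⁻¹ * cuspGen c h ^ N * γ i ∈ H) (P : GL ι ℂ) (D : ι → ℂ),
      ((P⁻¹ * ρ ⟨_, hu⟩ * P : GL ι ℂ) : Matrix ι ι ℂ) = Matrix.diagonal D := by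
  have key : ∀ i, ∃ l : ℕ, l ≠ 0 ∧ ∃ (hu : (γ i)⁻¹ * cuspGen c h ^ l * γ i ∈ H) (P : GL ι ℂ)
      (D : ι → ℂ), ((P⁻¹ * ρ ⟨_, hu⟩ * P : GL ι ℂ) : Matrix ι ι ℂ) = Matrix.diagonal D := by
    -- The conjugate `γ_i⁻¹ t_c γ_i` is the generator at the cusp `γ_i⁻¹ c` of `G`. This is also a
    -- cusp of `H`, of `l` times the width, so the `l`-th power is a generator on which `ρ` is
    -- diagonalizable.
    intro i
    obtain ⟨s, hs⟩ := toPSL_surjective (γ i)⁻¹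
    obtain ⟨c', h', -, -, -, hc', hgen⟩ := hc.exists_smul (g := s) (hs ▸ G.inv_mem (hγ i))
    obtain ⟨l, hl, hcl⟩ := hc'.exists_subgroup hHG hfin
    obtain ⟨P, Λ, hΛ⟩ := hρ c' _ hcl
    have h1 : (γ i)⁻¹ * cuspGen c h ^ l * γ i = cuspGen c' (l * h') := by
      have h2 := cuspGen_zpow c' h' l
      rw [Int.cast_natCast, ← hgen, hs, inv_inv, zpow_natCast] at h2
      rw [← h2]
      simpa using (conj_pow (i := l) (a := (γ i)⁻¹) (b := cuspGen c h)).symm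
    refine ⟨l, hl.ne', h1 ▸ hcl.mem, P, _, Eq.trans ?_ hΛ⟩
    simp only [h1]
  choose l hl hu P D hP using key
  -- The product is a common multiple of the exponents, and further powers stay diagonal in the same
  -- basis.
  refine ⟨∏ i, l i, Finset.prod_ne_zero_iff.2 fun i _ => hl i, fun i => ?_⟩
  obtain ⟨k, hk⟩ := Finset.dvd_prod_of_mem l (Finset.mem_univ i)
  have h1 : (γ i)⁻¹ * cuspGen c h ^ (∏ i, l i) * γ i =
      ((γ i)⁻¹ * cuspGen c h ^ l i * γ i) ^ k := by
    rw [hk, pow_mul]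
    simpa using (conj_pow (i := k) (a := (γ i)⁻¹) (b := cuspGen c h ^ l i)).symm
  have hu' := h1 ▸ H.pow_mem (hu i) k
  refine ⟨hu', P i, D i ^ k, ?_⟩
  have h2 : (⟨_, hu'⟩ : H) = ⟨_, hu i⟩ ^ k := Subtype.ext h1
  have h3 : (P i)⁻¹ * ρ ⟨_, hu i⟩ ^ k * P i = ((P i)⁻¹ * ρ ⟨_, hu i⟩ * P i) ^ k := by
    simpa using (conj_pow (i := k) (a := (P i)⁻¹) (b := ρ ⟨_, hu i⟩)).symm
  rw [h2, map_pow, h3, Units.val_pow_eq_pow_val, hP, Matrix.diagonal_pow]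

/-- The ring of block diagonal matrices, with blocks indexed by the first component. -/
def blockDiagonalHom (m : ℕ) (ι : Type*) [Fintype ι] [DecidableEq ι] :
    (Fin m → Matrix ι ι ℂ) →+* Matrix (Fin m × ι) (Fin m × ι) ℂ :=
  (Matrix.reindexAlgEquiv ℂ ℂ (Equiv.prodComm ι (Fin m))).toRingEquiv.toRingHom.comp
    (Matrix.blockDiagonalRingHom ι (Fin m) ℂ)

theorem blockDiagonalHom_apply (A : Fin m → Matrix ι ι ℂ) (p q : Fin m × ι) :
    blockDiagonalHom m ι A p q = if p.1 = q.1 then A p.1 p.2 q.2 else 0 :=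
  Matrix.blockDiagonal_apply _ _ _

/-- In general `t_c` permutes the cosets `γ_i H`, but `t_c^N` fixes each one. Its matrix is block
diagonal with blocks `ρ(γ_i⁻¹ t_c^N γ_i)`, diagonalized blockwise by `Q`; diagonalizability then
descends from the power to `t_c`. -/
theorem isAdmissible_indRep (hHG : H ≤ G) (hfin : H.relIndex G ≠ 0) {ρ : H →* GL ι ℂ}
    (hρ : IsAdmissible H ρ) (hγ : IsCosetReps G H γ) : IsAdmissible G (indRep ρ hγ) := by
  intro c h hc
  obtain ⟨N, hN, hkey⟩ := exists_pow_conj_diagonal hHG hfin hρ hγ.mem hc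
  choose hu P D hP using hkey
  have hT : indMatrix ρ γ (cuspGen c h ^ N) =
      blockDiagonalHom m ι fun i => (ρ ⟨_, hu i⟩ : Matrix ι ι ℂ) := by
    ext ⟨i, a⟩ ⟨j, b⟩
    rw [blockDiagonalHom_apply]
    simp only [indMatrix, Matrix.of_apply]
    split_ifs with hij
    · subst hij
      rw [extendByZero, dif_pos (hu i)]
    · rw [extendByZero, dif_neg]
      · rfl
      -- A nonzero block off the diagonal would force `γ_i H = γ_j H`.
      · intro hmem
        have h1 : (γ i)⁻¹ * γ j ∈ H := by
          have h2 := H.mul_mem (H.inv_mem (hu i)) hmem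
          convert h2 using 1
          group
        exact hij ((hγ.existsUnique (γ j) (hγ.mem j)).unique h1 (by simp))
  let Q : GL (Fin m × ι) ℂ :=
    Units.map (blockDiagonalHom m ι).toMonoidHom (MulEquiv.piUnits.symm P)
  refine exists_diagonal_exp_of_pow _ Q hN (fun p => D p.1 p.2) ?_
  rw [← map_pow]
  have h1 : ((Q⁻¹ * indRep ρ hγ (⟨cuspGen c h, hc.mem⟩ ^ N) * Q : GL (Fin m × ι) ℂ) :
      Matrix (Fin m × ι) (Fin m × ι) ℂ) =
      blockDiagonalHom m ι (fun i => (((P i)⁻¹ : GL ι ℂ) : Matrix ι ι ℂ)) *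
        indMatrix ρ γ (cuspGen c h ^ N) *
        blockDiagonalHom m ι (fun i => (P i : Matrix ι ι ℂ)) := rfl
  rw [h1, hT, ← map_mul, ← map_mul]
  ext ⟨i, a⟩ ⟨j, b⟩
  rw [blockDiagonalHom_apply]
  split_ifs with hij
  · obtain rfl : i = j := hij
    refine (congrFun (congrFun (hP i) a) b).trans ?_
    simp [Matrix.diagonal_apply]
  · rw [Matrix.diagonal_apply_ne]
    exact fun h2 => hij (congrArg Prod.fst h2)

/-- Row `i` has a single nonzero block, in the column `k` with `x γ_k H = γ_i H`. The element `u` is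
a separate variable so that a simplified form of `γ_i⁻¹ x γ_k` can be supplied. -/
theorem indRep_mulVec (ρ : H →* GL ι ℂ) (hγ : IsCosetReps G H γ) {x : PSL(2, ℝ)} (hx : x ∈ G)
    {i k : Fin m} {u : PSL(2, ℝ)} (hxu : (γ i)⁻¹ * x * γ k = u) (hu : u ∈ H) (V : Fin m × ι → ℂ) (a : ι) :
    ((indRep ρ hγ ⟨x, hx⟩ : Matrix (Fin m × ι) (Fin m × ι) ℂ) *ᵥ V) (i, a) =
      ((ρ ⟨u, hu⟩ : Matrix ι ι ℂ) *ᵥ fun b => V (k, b)) a := by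
  subst hxu
  change (indMatrix ρ γ x *ᵥ V) (i, a) = _
  rw [mulVec, dotProduct, Fintype.sum_prod_type, Finset.sum_eq_single k]
  · simp only [indMatrix, Matrix.of_apply, extendByZero, dif_pos hu]
    rfl
  · intro j _ hj
    refine Finset.sum_eq_zero fun b _ => ?_
    have h1 : (γ i)⁻¹ * x * γ j ∉ H := by
      intro hmem
      have h2 : (γ k)⁻¹ * γ j ∈ H := by
        have h3 := H.mul_mem (H.inv_mem hu) hmem
        convert h3 using 1
        group
      exact hj ((hγ.existsUnique (γ j) (hγ.mem j)).unique (by simp) h2)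
    simp only [indMatrix, Matrix.of_apply, extendByZero, dif_neg h1]
    simp
  · simp

variable {w : ℤ} {s : Fin m → SL(2, ℝ)}

theorem IsWeaklyHolomorphic.inducedForm (hHG : H ≤ G) (hfin : H.relIndex G ≠ 0)
    {ρ : H →* GL ι ℂ} (hρ : IsAdmissible H ρ) (hγ : IsCosetReps G H γ)
    (hs : ∀ i, toPSL (s i) = (γ i)⁻¹) {X : ℍ → ι → ℂ} (hX : IsWeaklyHolomorphic H w ρ X) :
    IsWeaklyHolomorphic G w (indRep ρ hγ) (inducedForm w s X) := by
  refine .of_expGrowth (fun p => mdifferentiable_slash (s p.1) hX.holo p.2) (fun x hx => ?_)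
    fun c h hc => ?_
  · funext τ
    ext ⟨i, a⟩
    -- The coset of `x⁻¹ γ_i` gives the `k` for which `u = γ_i⁻¹ x γ_k ∈ H`. Then `X|γ_i⁻¹ x = X|u
    -- γ_k⁻¹ = ρ(u) X|γ_k⁻¹`.
    obtain ⟨k, hk, -⟩ := hγ.existsUnique ((toPSL x)⁻¹ * γ i)
      (G.mul_mem (G.inv_mem hx) (hγ.mem i))
    have hu : (γ i)⁻¹ * toPSL x * γ k ∈ H := by
      have := H.inv_mem hk
      convert this using 1
      group
    rw [indRep_mulVec ρ hγ hx rfl hu]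
    have hv : toPSL (s i * x * (s k)⁻¹) = (γ i)⁻¹ * toPSL x * γ k := by
      rw [map_mul, map_mul, map_inv, hs, hs, inv_inv]
    have hmul : s i * x = s i * x * (s k)⁻¹ * s k := by group
    change slash w x (slash w (s i) X) τ a = _
    rw [← slash_mul, hmul, slash_mul, hX.slash_eq hv hu, slash_mulVec]
    rfl
  · refine .of_blocks fun i => ?_
    have h1 := hX.expGrowth_slash hHG hfin hρ hc (g := s i) (hs i ▸ G.inv_mem (hγ.mem i))
    have h2 : (fun τ a => slash w (cuspMatrix c) (VVMF.inducedForm w s X) τ (i, a)) =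
        slash w (cuspMatrix c) (slash w (s i) X) := rfl
    rwa [h2]

/-- For `x ∈ H` the conjugate `γ_i x γ_i⁻¹` fixes the coset `γ_i H`, with `(i, i)` block `ρ(x)`.
Hence the `i`-th block of `Y|γ_i` transforms under `H` by `ρ`. -/
theorem IsWeaklyHolomorphic.blockForm (hHG : H ≤ G) (hfin : H.relIndex G ≠ 0)
    {ρ : H →* GL ι ℂ} (hρ : IsAdmissible H ρ) (hγ : IsCosetReps G H γ)
    (hs : ∀ i, toPSL (s i) = (γ i)⁻¹) (i : Fin m) {Y : ℍ → Fin m × ι → ℂ}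
    (hY : IsWeaklyHolomorphic G w (indRep ρ hγ) Y) :
    IsWeaklyHolomorphic H w ρ (blockForm w s i Y) := by
  refine .of_expGrowth (fun a => mdifferentiable_slash (s i)⁻¹ hY.holo (i, a)) (fun x hx => ?_)
    fun c h hc => ?_
  · funext τ
    ext a
    have hmul : (s i)⁻¹ * x = (s i)⁻¹ * x * s i * (s i)⁻¹ := by group
    have hv : toPSL ((s i)⁻¹ * x * s i) = γ i * toPSL x * (γ i)⁻¹ := by
      rw [map_mul, map_mul, map_inv, hs, inv_inv]
    have hG : γ i * toPSL x * (γ i)⁻¹ ∈ G :=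
      G.mul_mem (G.mul_mem (hγ.mem i) (hHG hx)) (G.inv_mem (hγ.mem i))
    have hxi : (γ i)⁻¹ * (γ i * toPSL x * (γ i)⁻¹) * γ i = toPSL x := by group
    change slash w x (slash w (s i)⁻¹ Y) τ (i, a) = _
    rw [← slash_mul, hmul, slash_mul, hY.slash_eq hv hG, slash_mulVec]
    exact indRep_mulVec ρ hγ hG hxi hx _ a
  · obtain ⟨k, -, -, hk, -⟩ := hc.of_le hHG hfin
    -- A cusp of `H` is a cusp of `G`, so the growth statement is applied to `Y` with `G` as its own
    -- subgroup of index one.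
    have hself : G.relIndex G ≠ 0 := by simp
    exact (hY.expGrowth_slash le_rfl hself (isAdmissible_indRep hHG hfin hρ hγ) hk
      (g := (s i)⁻¹) (by
        rw [map_inv, hs, inv_inv]
        exact hγ.mem i)).block i

/-- Component `i` is the `k`-th block of `Y|γ_k γ_i⁻¹`. The only nonzero block in row `k` of the
matrix of `γ_k γ_i⁻¹` is in column `i` and equals `ρ(1) = 1`, so the `i`-th block of `Y` comes out,
whichever `k` was used. -/
theorem IsWeaklyHolomorphic.inducedForm_blockForm {ρ : H →* GL ι ℂ} (hγ : IsCosetReps G H γ)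
    (hs : ∀ i, toPSL (s i) = (γ i)⁻¹) (k : Fin m) {Y : ℍ → Fin m × ι → ℂ}
    (hY : IsWeaklyHolomorphic G w (indRep ρ hγ) Y) :
    VVMF.inducedForm w s (VVMF.blockForm w s k Y) = Y := by
  funext τ
  ext ⟨i, a⟩
  have hv : toPSL ((s k)⁻¹ * s i) = γ k * (γ i)⁻¹ := by
    rw [map_mul, map_inv, hs, hs, inv_inv]
  have hG : γ k * (γ i)⁻¹ ∈ G := G.mul_mem (hγ.mem k) (G.inv_mem (hγ.mem i))
  have hki : (γ k)⁻¹ * (γ k * (γ i)⁻¹) * γ i = 1 := by group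
  have h1 : (⟨1, H.one_mem⟩ : H) = 1 := rfl
  change slash w (s i) (slash w (s k)⁻¹ Y) τ (k, a) = _
  rw [← slash_mul, hY.slash_eq hv hG]
  refine (indRep_mulVec ρ hγ hG hki H.one_mem _ a).trans ?_
  rw [h1, map_one, Units.val_one, one_mulVec]

end Induced

/-- `X ↦ (X|γ_1⁻¹, …, X|γ_m⁻¹)` as a linear map over the modular functions of `G`. -/
def inductionMap {ι : Type*} [Fintype ι] [DecidableEq ι] {G H : Subgroup PSL(2, ℝ)} {m : ℕ}
    {γ : Fin m → PSL(2, ℝ)} (w : ℤ) (hHG : H ≤ G) (hfin : H.relIndex G ≠ 0)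
    {ρ : H →* GL ι ℂ} (hρ : IsAdmissible H ρ) (hγ : IsCosetReps G H γ) {s : Fin m → SL(2, ℝ)}
    (hs : ∀ i, toPSL (s i) = (γ i)⁻¹) :
    weaklyHolomorphicForms H w ρ (modularFunctionRing G) (modularFunctionRing_le hHG hfin)
      →ₗ[modularFunctionRing G]
    weaklyHolomorphicForms G w (indRep ρ hγ) (modularFunctionRing G) le_rfl where
  toFun X := ⟨inducedForm w s X, IsWeaklyHolomorphic.inducedForm hHG hfin hρ hγ hs X.2⟩
  map_add' X Y := by
    refine Subtype.ext (funext fun τ => funext fun p => ?_)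
    exact mul_add _ _ _
  map_smul' f X := by
    refine Subtype.ext (funext fun τ => funext fun p => ?_)
    -- Linearity needs invariance of `f` under all of `G`, since `γ_i⁻¹` need not lie in `H`.
    have hf : (f : ℍ → ℂ) (s p.1 • τ) = (f : ℍ → ℂ) τ :=
      (isModularFunction_iff.1 f.2).2.1 _ (hs p.1 ▸ G.inv_mem (hγ.mem p.1)) τ
    change autFactor (s p.1) τ ^ (-w) * ((f : ℍ → ℂ) (s p.1 • τ) * (X : ℍ → ι → ℂ) _ _) =
      (f : ℍ → ℂ) τ * (autFactor (s p.1) τ ^ (-w) * (X : ℍ → ι → ℂ) _ _)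
    rw [hf, mul_left_comm]

theorem inductionMap_bijective {ι : Type*} [Fintype ι] [DecidableEq ι] {G H : Subgroup PSL(2, ℝ)}
    {m : ℕ} [NeZero m] {γ : Fin m → PSL(2, ℝ)} (w : ℤ) (hHG : H ≤ G)
    (hfin : H.relIndex G ≠ 0) {ρ : H →* GL ι ℂ} (hρ : IsAdmissible H ρ)
    (hγ : IsCosetReps G H γ) {s : Fin m → SL(2, ℝ)} (hs : ∀ i, toPSL (s i) = (γ i)⁻¹) :
    Function.Bijective (inductionMap w hHG hfin hρ hγ hs) := by
  constructor
  · intro X X' hXX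
    exact Subtype.ext (inducedForm_injective w s 0 (congrArg Subtype.val hXX))
  · intro Y
    exact ⟨⟨blockForm w s 0 Y, Y.2.blockForm hHG hfin hρ hγ hs 0⟩,
      Subtype.ext (Y.2.inducedForm_blockForm hγ hs 0)⟩

end VVMF

/-! ### The induction isomorphism -/

open VVMF
theorem mainTheorem1 (G H : Subgroup PSL(2, ℝ)) (hG : IsFuchsianFirstKind G) (hHG : H ≤ G)
    (m : ℕ) [NeZero m] (hm : H.relIndex G = m)
    (d : ℕ) (ρ : H →* GL (Fin d) ℂ) (hρ : IsAdmissible H ρ) (w : ℤ) (hw : Even w)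
    (γ : Fin m → PSL(2, ℝ)) (hγ : IsCosetReps G H γ) :
    IsAdmissible G (indRep ρ hγ) ∧
    ∃ Φ : weaklyHolomorphicForms H w ρ (modularFunctionRing G)
          (modularFunctionRing_le hHG (hm.trans_ne (NeZero.ne m))) ≃ₗ[modularFunctionRing G]
        weaklyHolomorphicForms G w (indRep ρ hγ) (modularFunctionRing G) le_rfl,
      (∀ X (i : Fin m) (s : SL(2, ℝ)), toPSL s = (γ i)⁻¹ → ∀ (τ : ℍ) (a : Fin d),
        (Φ X : ℍ → Fin m × Fin d → ℂ) τ (i, a) =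
          autFactor s τ ^ (-w) * (X : ℍ → Fin d → ℂ) (s • τ) a) ∧
      (γ 0 = 1 → ∀ Y (τ : ℍ) (a : Fin d),
        (Φ.symm Y : ℍ → Fin d → ℂ) τ a = (Y : ℍ → Fin m × Fin d → ℂ) τ (0, a)) := by
  have hfin : H.relIndex G ≠ 0 := hm.trans_ne (NeZero.ne m)
  choose s hs using fun i => toPSL_surjective (γ i)⁻¹
  let Φ := LinearEquiv.ofBijective (inductionMap w hHG hfin hρ hγ hs)
    (inductionMap_bijective w hHG hfin hρ hγ hs)
  have hΦ : ∀ X (i : Fin m) (t : SL(2, ℝ)), toPSL t = (γ i)⁻¹ → ∀ (τ : ℍ) (a : Fin d),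
      (Φ X : ℍ → Fin m × Fin d → ℂ) τ (i, a) =
        autFactor t τ ^ (-w) * (X : ℍ → Fin d → ℂ) (t • τ) a := by
    intro X i t ht τ a
    change slash w (s i) X τ a = slash w t X τ a
    rw [slash_congr hw ((hs i).trans ht.symm)]
  refine ⟨isAdmissible_indRep hHG hfin hρ hγ, Φ, hΦ, fun h0 Y τ a => ?_⟩
  -- The chosen lift `s 0` of `γ_0⁻¹ = 1` may be `-1`; the formula for arbitrary lifts allows the
  -- lift `1` instead.
  have h1 := hΦ (Φ.symm Y) 0 1 (by rw [h0, map_one, inv_one]) τ a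
  rw [Φ.apply_symm_apply, autFactor_one, _root_.one_zpow, one_mul, one_smul] at h1
  exact h1.symm
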